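/- \textbf{Setting.} Let $d\ge 1$, $\mathcal X=[0,1]^d$, $\mathcal O=\mathcal X\times\{0,1\}\times\{0,1\}\ni o=(x,a,y)$, and let $\lambda\colon[0,1]\to\mathbb R_{\ge0}$ be a function with derivative $\dot\lambda$ where it is differentiable. For $U=(q_1,q_0,e)\in C(\mathcal X)^3$ put $\|U\|_\infty=\max\{\|q_1\|_\infty,\|q_0\|_\infty,\|e\|_\infty\}$, $\mathcal B_r(U_0)=\{U\in C(\mathcal X)^3:\|U-U_0\|_\infty\le r\}$, $\tau=q_1-q_0$ and $$p_U(a,y\mid x)=e(x)^a(1-e(x))^{1-a}q_a(x)^y(1-q_a(x))^{1-y}.$$ For a probability measure $Q$ on $\mathcal X$ let $\widetilde P(Q,U)$ be the law of $(X,A,Y)$ with $X\sim Q$ and $(A,Y)\mid X=x\sim p_U(\cdot,\cdot\mid x)$, and set $\Omega=\mathbb E_Q[\lambda(e(X))]$, $\psi=\mathbb E_Q[\lambda(e(X))\tau(X)]/\Omega$, $$D^*(o;\widetilde P(Q,U))=\frac{\lambda(e(x))}{\Omega}\Big[\frac{a}{e(x)}(y-q_1(x))-\frac{1-a}{1-e(x)}(y-q_0(x))\Big]+\frac{\dot\lambda(e(x))}{\Omega}(\tau(x)-\psi)(a-e(x)),$$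 $$F(Q,U)=\Big(\frac{q_1(1-q_1)\lambda(e)}{\Omega e},\ -\frac{q_0(1-q_0)\lambda(e)}{\Omega(1-e)},\ \frac{e(1-e)\dot\lambda(e)}{\Omega}(\tau-\psi)\Big).$$ \textbf{Local bracketing conditions.} Let $P^*$ be a probability measure on $\mathcal O$ with $P^*\ll$ Lebesgue $\otimes$ counting $\otimes$ counting, and let $p^*(a,y\mid x)$ be a version of the conditional law of $(A,Y)$ given $X=x$ under $P^*$. The pair $(Q,U_0)$ satisfies the local bracketing conditions with constants $(\mathfrak c,c_{\rm init})$ if there is $\eta\in(0,1/4)$ such that: (1) every $U\in\mathcal B_{2\eta}(U_0)$ has all its components valued in $[\eta,1-\eta]$; $\lambda$ is $C^3$ on $[\eta,1-\eta]$; $\Lambda_{\min}=\inf_{[\eta,1-\eta]}\lambda>0$; and $\mathfrak c$ is the largest positive real with $\mathfrak c\le\min\{\Lambda_{\min},\eta\}$ and $\max\{\sup\lambda,\sup|\dot\lambda|,\sup|\lambda''|,\sup|\lambda'''|,\eta\}\le\mathfrak c^{-1}$, the suprema being over $[\eta,1-\eta]$; (2) $Q$ is absolutely continuous or pure point, $c_{\rm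 init}\in(0,1)$, and $\mathbb E_{\widetilde P(Q,U_0)}\big[D^*(O;\widetilde P(Q,U_0))^2\big]\ge c_{\rm init}$; (3) there is a triple $U^*=(q_1^*,q_0^*,e^*)\in\mathcal B_\eta(U_0)$ of continuous versions of the nuisance functions $q_a^*(x)=\mathbb E^*[Y\mid A=a,X=x]$, $e^*(x)=P^*(A=1\mid X=x)$ of $P^*$, and $$\mathbb E_Q\Big[\tfrac12\sum_{a,y}\big|p^*(a,y\mid X)-p_{U_0}(a,y\mid X)\big|\Big]\le\frac{\mathfrak c^{10}c_{\rm init}}{600};$$ (4) $\displaystyle\Big|\mathbb E_Q\Big[\sum_{a,y}D^*\big((X,a,y);\widetilde P(Q,U_0)\big)\,p^*(a,y\mid X)\Big]\Big|\le\frac{c_{\rm init}\delta_{\rm init}}{8}$, where $\delta_{\rm init}=c_{\rm init}\mathfrak c^{20}/10^6$. \textbf{Theorem.} Let $\mathfrak c>0$, $c_{\rm init}\in(0,1)$ and $\mathfrak t_1=\mathfrak c^6/8$. There exist constants $\mathfrak t_2\in(0,\mathfrak t_1)$ and $m_0>0$, depending only on $(\mathfrak c,c_{\rm init})$, such that the following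 holds for all $d,n\ge1$, $P^*$, $p^*$ and $\lambda$ as above. Let $(X_i,A_i,Y_i)$, $i=1,\dots,n$, be $\mathcal O$-valued random variables on a probability space with probability $\mathbb P$, let $\mathcal G_n$ be a sub-$\sigma$-field, and let $U_0$ be a $\mathcal G_n$-measurable random element of $C(\mathcal X;[0,1])^3$. Suppose that $X_1,\dots,X_n$ are $\mathcal G_n$-measurable and that, conditionally on $\mathcal G_n$, the pairs $(A_i,Y_i)$ are independent with $\mathbb P((A_i,Y_i)=(a,y)\mid\mathcal G_n)=p^*(a,y\mid X_i)$. Let $Q_n=\frac1n\sum_{i=1}^n\delta_{X_i}$, and let $\mathcal A_n\in\mathcal G_n$ be an event on which $(Q_n,U_0)$ satisfies the local bracketing conditions with constants $(\mathfrak c,c_{\rm init})$. Then on $\mathcal A_n$ there is a unique path $U\in C^1((-\mathfrak t_1,\mathfrak t_1);C(\mathcal X)^3)$, $t\mapsto U_t$, starting at $U_0$ at $t=0$, solving $\frac{d}{dt}U_t=F(Q_n,U_t)$ on $(-\mathfrak t_1,\mathfrak t_1)$ and staying in $\mathcal B_\eta(U_0)$ for some $\eta$ as in (1). Define $L_n(t)=\frac1n\sum_{i=1}^n\log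 p_{U_t}(A_i,Y_i\mid X_i)$ on $\mathcal A_n$ and $L_n(t)=0$ on $\mathcal A_n^c$, for $|t|<\mathfrak t_1$. On $\mathcal A_n$ we have $L_n\in C^2((-\mathfrak t_1,\mathfrak t_1))$ and $$L_n'(t)=\frac1n\sum_{i=1}^nD^*\big((X_i,A_i,Y_i);\widetilde P(Q_n,U_t)\big),\qquad |t|<\mathfrak t_1.$$ Moreover, let $\mathcal E_n$ be the subset of $\mathcal A_n$ on which there is a unique $\hat t\in[-\mathfrak t_2,\mathfrak t_2]$ with $L_n'(\hat t)=0$. Then $\mathcal E_n$ is an event and, almost surely, $$\mathbf 1_{\mathcal A_n}\,\mathbb P(\mathcal E_n^c\mid\mathcal G_n)\le\frac1{m_0}\exp(-m_0n).$$ -/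

import Mathlib

open MeasureTheory ProbabilityTheory Set
open scoped ENNReal

namespace WATE

noncomputable section

/-- The covariate space `[0,1]^d`. -/
abbrev Cov (d : ℕ) : Type := Fin d → unitInterval

/-- The sample space `[0,1]^d × {0,1} × {0,1}`; a point is `(x, a, y)`. -/
abbrev Obs (d : ℕ) : Type := Cov d × (Fin 2 × Fin 2)

/-- Triples `U = (q₁, q₀, e)` in `C(𝒳)³`. The norm is the maximum of the three sup norms. -/
abbrev Nuis (d : ℕ) : Type := C(Cov d, ℝ) × C(Cov d, ℝ) × C(Cov d, ℝ)

/-- The treated outcome regression `q₁`. -/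
def q1 {d : ℕ} (U : Nuis d) : Cov d → ℝ := fun x => U.1 x

/-- The control outcome regression `q₀`. -/
def q0 {d : ℕ} (U : Nuis d) : Cov d → ℝ := fun x => U.2.1 x

/-- The propensity score `e`. -/
def ps {d : ℕ} (U : Nuis d) : Cov d → ℝ := fun x => U.2.2 x

/-- `x ↦ q_a(x)`. -/
def qa {d : ℕ} (U : Nuis d) (a : Fin 2) : Cov d → ℝ := if a = 1 then q1 U else q0 U

/-- The contrast `τ(U) = q₁ - q₀`. -/
def tau {d : ℕ} (U : Nuis d) (x : Cov d) : ℝ := q1 U x - q0 U x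

/-- All three nuisance functions take values in the set `s`. -/
def ValuesIn {d : ℕ} (U : Nuis d) (s : Set ℝ) : Prop :=
  ∀ x, q1 U x ∈ s ∧ q0 U x ∈ s ∧ ps U x ∈ s

/-- The conditional probability
`p_U(a,y|x) = e(x)^a (1-e(x))^(1-a) q_a(x)^y (1-q_a(x))^(1-y)`. -/
def pU {d : ℕ} (U : Nuis d) (a y : Fin 2) (x : Cov d) : ℝ :=
  ps U x ^ (a : ℕ) * (1 - ps U x) ^ (1 - (a : ℕ)) *
    (qa U a x ^ (y : ℕ) * (1 - qa U a x) ^ (1 - (y : ℕ)))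

/-- The law `P̃(Q,U)` of `(X,A,Y)` with `X ∼ Q` and `(A,Y) | X = x` distributed as
`p_U(·,·|x)`, given by its density with respect to `Q ⊗ counting ⊗ counting`. -/
def Ptilde {d : ℕ} (Q : Measure (Cov d)) (U : Nuis d) : Measure (Obs d) :=
  (Q.prod (Measure.count.prod Measure.count)).withDensity
    (fun o => ENNReal.ofReal (pU U o.2.1 o.2.2 o.1))

/-- `Ω(Q,U) = E_Q[λ(e(X))]`. -/
def Omega {d : ℕ} (lam : ℝ → ℝ) (Q : Measure (Cov d)) (U : Nuis d) : ℝ :=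
  ∫ x, lam (ps U x) ∂Q

/-- The weighted average treatment effect `ψ(Q,U) = E_Q[λ(e(X)) τ(X)] / Ω(Q,U)`. -/
def psi {d : ℕ} (lam : ℝ → ℝ) (Q : Measure (Cov d)) (U : Nuis d) : ℝ :=
  (∫ x, lam (ps U x) * tau U x ∂Q) / Omega lam Q U

/-- The augmented inverse probability weighted pseudo-outcome `φ`. -/
def phi {d : ℕ} (U : Nuis d) (o : Obs d) : ℝ :=
  ((o.2.1 : ℕ) : ℝ) / ps U o.1 * (((o.2.2 : ℕ) : ℝ) - q1 U o.1)
    - (1 - ((o.2.1 : ℕ) : ℝ)) / (1 - ps U o.1) * (((o.2.2 : ℕ) : ℝ) - q0 U o.1)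
    + tau U o.1

/-- The restricted-model efficient influence function `D*(o; P̃(Q,U))`. -/
def Dstar {d : ℕ} (lam : ℝ → ℝ) (Q : Measure (Cov d)) (U : Nuis d) (o : Obs d) : ℝ :=
  lam (ps U o.1) / Omega lam Q U * (phi U o - tau U o.1)
    + deriv lam (ps U o.1) / Omega lam Q U * (tau U o.1 - psi lam Q U)
      * (((o.2.1 : ℕ) : ℝ) - ps U o.1)

/-- First component of the vector field `F(Q,U)`. -/
def F1 {d : ℕ} (lam : ℝ → ℝ) (Q : Measure (Cov d)) (U : Nuis d) (x : Cov d) : ℝ :=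
  q1 U x * (1 - q1 U x) * lam (ps U x) / (Omega lam Q U * ps U x)

/-- Second component of the vector field `F(Q,U)`. -/
def F0 {d : ℕ} (lam : ℝ → ℝ) (Q : Measure (Cov d)) (U : Nuis d) (x : Cov d) : ℝ :=
  -(q0 U x * (1 - q0 U x) * lam (ps U x) / (Omega lam Q U * (1 - ps U x)))

/-- Third component of the vector field `F(Q,U)`. -/
def Fe {d : ℕ} (lam : ℝ → ℝ) (Q : Measure (Cov d)) (U : Nuis d) (x : Cov d) : ℝ :=
  ps U x * (1 - ps U x) * deriv lam (ps U x) / Omega lam Q U * (tau U x - psi lam Q U)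

/-- `inf λ` over `[η, 1-η]`. -/
def LamMin (lam : ℝ → ℝ) (η : ℝ) : ℝ := sInf (lam '' Icc η (1 - η))

/-- `sup |λ^{(k)}|` over `[η, 1-η]`. For `k = 0` and `λ ≥ 0` this is `sup λ`. -/
def LamMax (lam : ℝ → ℝ) (η : ℝ) (k : ℕ) : ℝ :=
  sSup ((fun u => |iteratedDerivWithin k lam (Icc η (1 - η)) u|) '' Icc η (1 - η))

/-- `c` is the largest positive real number with `c ≤ min {Λ_min, η}` and
`max {Λ_max, Λ'_max, Λ_{2,max}, Λ_{3,max}, η} ≤ c⁻¹`. -/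
def IsRegConst (lam : ℝ → ℝ) (η c : ℝ) : Prop :=
  IsGreatest {c : ℝ | 0 < c ∧ c ≤ min (LamMin lam η) η ∧
    max (LamMax lam η 0) (max (LamMax lam η 1) (max (LamMax lam η 2)
      (max (LamMax lam η 3) η))) ≤ c⁻¹} c

/-- Positivity and smoothness with margin `η`. Finiteness of the suprema of `|λ^{(k)}|`, `k ≤ 3`,
over `[η, 1-η]` is automatic from the `C³` condition on this compact interval. -/
def Positivity {d : ℕ} (lam : ℝ → ℝ) (U0 : Nuis d) (η : ℝ) : Prop :=
  η ∈ Ioo (0 : ℝ) (1 / 4) ∧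
  (∀ U : Nuis d, ‖U - U0‖ ≤ 2 * η → ValuesIn U (Icc η (1 - η))) ∧
  ContDiffOn ℝ 3 lam (Icc η (1 - η)) ∧
  0 < LamMin lam η

/-- `U` consists of continuous versions of the nuisance functions of `Pstar`:
`e(X) = E[A | X]` and `q_A(X) = E[Y | X, A]` almost surely. -/
def IsNuisanceOf {d : ℕ} (Pstar : Measure (Obs d)) (U : Nuis d) : Prop :=
  (Pstar[fun o => ((o.2.1 : ℕ) : ℝ) |
      MeasurableSpace.comap (fun o : Obs d => o.1) inferInstance]
    =ᵐ[Pstar] fun o => ps U o.1) ∧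
  (Pstar[fun o => ((o.2.2 : ℕ) : ℝ) |
      MeasurableSpace.comap (fun o : Obs d => (o.1, o.2.1)) inferInstance]
    =ᵐ[Pstar] fun o => qa U o.2.1 o.1)

/-- A measure carried by a countable set. -/
def PurePoint {α : Type*} [MeasurableSpace α] (Q : Measure α) : Prop :=
  ∃ S : Set α, S.Countable ∧ Q Sᶜ = 0

/-- The constant `δ_init`. -/
def deltaInit (c cinit : ℝ) : ℝ := cinit * c ^ 20 / 10 ^ 6

/-- The local bracketing conditions with constants `(c, cinit)`. The Markov kernel `pc` is the
conditional law `p*(·,·|x)` of `(A,Y)` given `X = x` under `Pstar`. -/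
def LocalBracketing {d : ℕ} (Pstar : Measure (Obs d)) (pc : Kernel (Cov d) (Fin 2 × Fin 2))
    (lam : ℝ → ℝ) (Q : Measure (Cov d)) (U0 : Nuis d) (c cinit : ℝ) : Prop :=
  ∃ η : ℝ,
    Positivity lam U0 η ∧ IsRegConst lam η c ∧
    -- nondegeneracy of the initial score
    ((Q ≪ volume ∨ PurePoint Q) ∧ cinit ∈ Ioo (0 : ℝ) 1 ∧
      cinit ≤ ∫ o, Dstar lam Q U0 o ^ 2 ∂(Ptilde Q U0)) ∧
    -- closeness of the initial conditional law to the truth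
    ((∃ Ustar : Nuis d, IsNuisanceOf Pstar Ustar ∧ ‖Ustar - U0‖ ≤ η) ∧
      ∫ x, (1 / 2 : ℝ) * ∑ a : Fin 2, ∑ y : Fin 2, |(pc x).real {(a, y)} - pU U0 a y x| ∂Q
        ≤ c ^ 10 * cinit / 600) ∧
    -- small initial score bias
    |∫ x, ∑ a : Fin 2, ∑ y : Fin 2,
        Dstar lam Q U0 (x, (a, y)) * (pc x).real {(a, y)} ∂Q|
      ≤ cinit * deltaInit c cinit / 8

/-- The time horizon `𝔱₁ = c⁶/8`. -/
def t1 (c : ℝ) : ℝ := c ^ 6 / 8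

/-- `U ∈ C¹((-𝔱₁,𝔱₁); C(𝒳)³)` solves `U(0) = U₀`, `dU_t/dt = F(Q,U_t)` in `C(𝒳)³` on
`(-𝔱₁,𝔱₁)` and stays in the closed ball of radius `η` about `U₀`. Only the restriction of `U` to
`(-𝔱₁,𝔱₁)` matters. -/
def IsPath {d : ℕ} (lam : ℝ → ℝ) (Q : Measure (Cov d)) (U0 : Nuis d) (c : ℝ)
    (U : ℝ → Nuis d) : Prop :=
  U 0 = U0 ∧ ContDiffOn ℝ 1 U (Ioo (-t1 c) (t1 c)) ∧
  (∀ t ∈ Ioo (-t1 c) (t1 c), ∀ x,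
    q1 (deriv U t) x = F1 lam Q (U t) x ∧
    q0 (deriv U t) x = F0 lam Q (U t) x ∧
    ps (deriv U t) x = Fe lam Q (U t) x) ∧
  ∃ η : ℝ, Positivity lam U0 η ∧ IsRegConst lam η c ∧
    ∀ t ∈ Ioo (-t1 c) (t1 c), ‖U t - U0‖ ≤ η

open Classical in
/-- The solution path `t ↦ U_t` started at `U₀` (the constant path if there is no solution). -/
def path {d : ℕ} (lam : ℝ → ℝ) (Q : Measure (Cov d)) (U0 : Nuis d) (c : ℝ) : ℝ → Nuis d :=
  if h : ∃ U : ℝ → Nuis d, IsPath lam Q U0 c U then h.choose else fun _ => U0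

/-- The empirical measure `(1/n) ∑ δ_{x_i}`. -/
def empirical {d n : ℕ} (x : Fin n → Cov d) : Measure (Cov d) :=
  (n : ℝ≥0∞)⁻¹ • ∑ i, Measure.dirac (x i)

open Classical in
/-- The random function `L_n`: on the event `An` it is the empirical conditional log-likelihood
along the path started at `U₀(ω)` with covariate law `Q_n`, and it vanishes off `An`. -/
def Ln {d n : ℕ} {Om : Type*} (lam : ℝ → ℝ) (c : ℝ) (X : Fin n → Om → Cov d)
    (A Y : Fin n → Om → Fin 2) (U0 : Om → Nuis d) (An : Set Om) (w : Om) (t : ℝ) : ℝ :=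
  if w ∈ An then
    (1 / (n : ℝ)) * ∑ i, Real.log
      (pU (path lam (empirical fun j => X j w) (U0 w) c t) (A i w) (Y i w) (X i w))
  else 0

/-- The event `ℰ_n ⊆ An` on which `L_n'` has exactly one zero in `[-t₂, t₂]`. -/
def En {d n : ℕ} {Om : Type*} (lam : ℝ → ℝ) (c t2 : ℝ) (X : Fin n → Om → Cov d)
    (A Y : Fin n → Om → Fin 2) (U0 : Om → Nuis d) (An : Set Om) : Set Om :=
  {w | w ∈ An ∧ ∃! t : ℝ, t ∈ Icc (-t2) t2 ∧ deriv (Ln lam c X A Y U0 An w) t = 0}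

/-- Conditional independence given `G` of finitely many `β`-valued random variables, through
conditional probabilities of measurable sets (no assumption on the probability space). -/
def CondIndepGiven {Om β : Type*} {n : ℕ} [MeasurableSpace β] (G : MeasurableSpace Om)
    [mOm : MeasurableSpace Om] (P : Measure Om) (Z : Fin n → Om → β) : Prop :=
  ∀ (S : Finset (Fin n)) (B : Fin n → Set β), (∀ i ∈ S, MeasurableSet (B i)) →
    P⟦⋂ i ∈ S, Z i ⁻¹' B i | G⟧ =ᵐ[P] ∏ i ∈ S, P⟦Z i ⁻¹' B i | G⟧

end

end WATE

open WATE

/-! The field `F` is chosen so that `p_{U_t}` has logarithmic time derivative `D*` along a solution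
(`PathAt.hasDerivAt_pU`). Thus `L_n'` is an empirical score, and the theorem is about a
one-dimensional likelihood equation.

Given `G_n`, both `L_n'(0)` and `L_n''(0)` are averages of bounded independent variables. The mean
of `L_n'(0)` is small by the bias condition. For `L_n''(0)`, the information identity under
`p_{U_0}` gives mean `-E[D*²] ≤ -c_init`, and closeness of `p*` to `p_{U_0}` costs at most `3 c_init
/ 20` (`LocalBracketing.mean_curvature`). Hoeffding's inequality keeps both averages near their
means up to probability `4 exp(-κ n)`. Since `L_n''` is Lipschitz with a constant depending only on
`c` (`PathAt.bddC11_Dstar`), it then stays below `-c_init/2` on `[-δ_init, δ_init]`. There `L_n'` is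
strictly decreasing and small at `0`, so it has exactly one zero
(`LocalBracketing.existsUnique_zero`).

The path comes from a truncated field, globally bounded and Lipschitz, to which Picard–Lindelöf and
Grönwall apply. Its speed `3 c⁻⁴` over the horizon `c⁶/8` is too small to leave the `η`-ball, so the
truncation is never active.

For measurability and conditioning, the labels take finitely many values. With the labels frozen,
the score at each time is a continuous function of `(U_0, X)` (`exists_continuous_score`), so the
event of a unique zero is `G_n`-measurable. The conditional probability of failure becomes a finite
sum, which is the product-measure probability that Hoeffding bounds. -/

open scoped NNReal

namespace WATE

/-! ### Autonomous Lipschitz differential equations in a Banach space. -/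

section ODE

variable {E : Type*} [NormedAddCommGroup E] [NormedSpace ℝ E]

/-- A bounded, globally Lipschitz vector field on a Banach space has a solution from each initial
value on each symmetric time interval. -/
theorem exists_solution_of_lipschitz_of_bounded [CompleteSpace E] {f : E → E} {K V : ℝ≥0}
    (hf : LipschitzWith K f) (hV : ∀ x, ‖f x‖ ≤ V) {T : ℝ} (hT : 0 < T) (x : E) :
    ∃ u : ℝ → E, u 0 = x ∧ ∀ t ∈ Ioo (-T) T, HasDerivAt u (f (u t)) t := by
  have h0 : (0 : ℝ) ∈ Icc (-T) T := ⟨by linarith, hT.le⟩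
  -- A ball of radius `V * T` contains everything reachable at speed `V` in time `T`, so global
  -- bounds remove the usual restriction on the length of the time interval.
  have hPL : IsPicardLindelof (fun _ : ℝ => f) (⟨0, h0⟩ : Icc (-T) T) x (V * NNReal.mk T hT.le) 0 V K := by
    refine IsPicardLindelof.of_time_independent (fun y _ => hV y) hf.lipschitzOnWith ?_
    simp only [sub_zero, zero_sub, neg_neg, max_self, NNReal.coe_zero]
    exact le_rfl
  obtain ⟨u, hu0, hu⟩ := hPL.exists_eq_forall_mem_Icc_hasDerivWithinAt₀
  exact ⟨u, hu0, fun t ht => (hu t (Ioo_subset_Icc_self ht)).hasDerivAt (Icc_mem_nhds ht.1 ht.2)⟩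

theorem dist_solution_le_of_nonneg {f : E → E} {K : ℝ≥0} (hf : LipschitzWith K f) {T : ℝ}
    {u v : ℝ → E} (hu : ∀ t ∈ Ioo (-T) T, HasDerivAt u (f (u t)) t)
    (hv : ∀ t ∈ Ioo (-T) T, HasDerivAt v (f (v t)) t) {t : ℝ} (h0 : 0 ≤ t) (ht : t < T) :
    dist (u t) (v t) ≤ dist (u 0) (v 0) * Real.exp (K * t) := by
  have hI : ∀ s ∈ Icc (0 : ℝ) t, s ∈ Ioo (-T) T := fun s hs =>
    ⟨by linarith [hs.1], by linarith [hs.2]⟩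
  have := dist_le_of_trajectories_ODE (v := fun _ => f) (f := u) (g := v) (a := 0) (b := t)
    (δ := dist (u 0) (v 0)) (fun _ => hf)
    (fun s hs => (hu s (hI s hs)).continuousAt.continuousWithinAt)
    (fun s hs => (hu s (hI s (Ico_subset_Icc_self hs))).hasDerivWithinAt)
    (fun s hs => (hv s (hI s hs)).continuousAt.continuousWithinAt)
    (fun s hs => (hv s (hI s (Ico_subset_Icc_self hs))).hasDerivWithinAt) le_rfl t ⟨h0, le_rfl⟩
  simpa using this

theorem hasDerivAt_comp_neg_of_solution {f : E → E} {T : ℝ}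
    {u : ℝ → E} (hu : ∀ t ∈ Ioo (-T) T, HasDerivAt u (f (u t)) t) :
    ∀ t ∈ Ioo (-T) T, HasDerivAt (fun s => u (-s)) (-f (u (-t))) t := by
  intro t ht
  have h := hu (-t) ⟨by linarith [ht.2], by linarith [ht.1]⟩
  simpa [Function.comp_def] using h.scomp t (hasDerivAt_neg t)

/-- Two solutions of an autonomous Lipschitz differential equation separate at most
exponentially fast, in both time directions. -/
theorem dist_solution_le {f : E → E} {K : ℝ≥0} (hf : LipschitzWith K f) {T : ℝ}
    {u v : ℝ → E} (hu : ∀ t ∈ Ioo (-T) T, HasDerivAt u (f (u t)) t)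
    (hv : ∀ t ∈ Ioo (-T) T, HasDerivAt v (f (v t)) t) {t : ℝ} (ht : t ∈ Ioo (-T) T) :
    dist (u t) (v t) ≤ dist (u 0) (v 0) * Real.exp (K * |t|) := by
  rcases le_total 0 t with h | h
  · rw [abs_of_nonneg h]
    exact dist_solution_le_of_nonneg hf hu hv h ht.2
  · rw [abs_of_nonpos h]
    have hf' : LipschitzWith K (fun x => -f x) := LipschitzWith.of_dist_le_mul fun x y => by
      rw [dist_neg_neg]; exact hf.dist_le_mul x y
    have := dist_solution_le_of_nonneg (f := fun x => -f x) (T := T) hf'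
      (hasDerivAt_comp_neg_of_solution hu) (hasDerivAt_comp_neg_of_solution hv)
      (t := -t) (by linarith) (by linarith [ht.1])
    simpa using this

theorem norm_solution_sub_le {f : E → E} {V : ℝ} (hV : ∀ x, ‖f x‖ ≤ V) {T : ℝ}
    {u : ℝ → E} (hu : ∀ t ∈ Ioo (-T) T, HasDerivAt u (f (u t)) t) {s t : ℝ}
    (hs : s ∈ Ioo (-T) T) (ht : t ∈ Ioo (-T) T) :
    ‖u t - u s‖ ≤ V * |t - s| :=
  (convex_Ioo (-T) T).norm_image_sub_le_of_norm_hasDerivWithin_le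
    (fun r hr => (hu r hr).hasDerivWithinAt) (fun r _ => hV (u r)) hs ht

end ODE

/-! ### The weight function and its global Lipschitz extension. -/

/-- The regularity of the weight function in the local bracketing conditions. -/
structure RegularWeight (lam : ℝ → ℝ) (c η : ℝ) : Prop where
  pos : 0 < c
  mem : η ∈ Ioo (0 : ℝ) (1 / 4)
  contDiffOn : ContDiffOn ℝ 3 lam (Icc η (1 - η))
  isRegConst : IsRegConst lam η c

namespace RegularWeight

variable {lam : ℝ → ℝ} {c η : ℝ}

theorem le_margin (h : RegularWeight lam c η) : c ≤ η :=
  h.isRegConst.1.2.1.trans (min_le_right _ _)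

theorem lt_quarter (h : RegularWeight lam c η) : c < 1 / 4 := h.le_margin.trans_lt h.mem.2

theorem uniqueDiffOn (h : RegularWeight lam c η) : UniqueDiffOn ℝ (Icc η (1 - η)) :=
  uniqueDiffOn_Icc (by linarith [h.mem.1, h.mem.2])

theorem le_weight (h : RegularWeight lam c η) {u : ℝ} (hu : u ∈ Icc η (1 - η)) : c ≤ lam u :=
  (h.isRegConst.1.2.1.trans (min_le_left _ _)).trans
    (csInf_le (isCompact_Icc.image_of_continuousOn h.contDiffOn.continuousOn).bddBelow
      (mem_image_of_mem _ hu))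

theorem abs_iteratedDerivWithin_le (h : RegularWeight lam c η) {k : ℕ} (hk : k ≤ 3) {u : ℝ}
    (hu : u ∈ Icc η (1 - η)) : |iteratedDerivWithin k lam (Icc η (1 - η)) u| ≤ c⁻¹ := by
  have hcont : ContinuousOn (fun u => |iteratedDerivWithin k lam (Icc η (1 - η)) u|)
      (Icc η (1 - η)) :=
    (h.contDiffOn.continuousOn_iteratedDerivWithin (by exact_mod_cast hk) h.uniqueDiffOn).abs
  have h1 : |iteratedDerivWithin k lam (Icc η (1 - η)) u| ≤ LamMax lam η k :=
    le_csSup (isCompact_Icc.image_of_continuousOn hcont).bddAbove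
      (mem_image_of_mem (fun u => |iteratedDerivWithin k lam (Icc η (1 - η)) u|) hu)
  refine h1.trans (le_trans ?_ h.isRegConst.1.2.2)
  interval_cases k <;> simp

theorem weight_le (h : RegularWeight lam c η) {u : ℝ} (hu : u ∈ Icc η (1 - η)) :
    lam u ≤ c⁻¹ := by
  simpa using (le_abs_self _).trans (h.abs_iteratedDerivWithin_le (k := 0) (by norm_num) hu)

theorem hasDerivAt_iteratedDerivWithin (h : RegularWeight lam c η) {k : ℕ} (hk : k < 3) {u : ℝ}
    (hu : u ∈ Ioo η (1 - η)) :
    HasDerivAt (iteratedDerivWithin k lam (Icc η (1 - η)))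
      (iteratedDerivWithin (k + 1) lam (Icc η (1 - η)) u) u := by
  have hd := (h.contDiffOn.differentiableOn_iteratedDerivWithin (m := k)
    (by exact_mod_cast hk) h.uniqueDiffOn) u (Ioo_subset_Icc_self hu)
  rw [iteratedDerivWithin_succ]
  exact hd.hasDerivWithinAt.hasDerivAt (Icc_mem_nhds hu.1 hu.2)

theorem hasDerivAt_weight (h : RegularWeight lam c η) {u : ℝ} (hu : u ∈ Ioo η (1 - η)) :
    HasDerivAt lam (iteratedDerivWithin 1 lam (Icc η (1 - η)) u) u := by
  simpa only [iteratedDerivWithin_zero] using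
    h.hasDerivAt_iteratedDerivWithin (k := 0) (by norm_num) hu

theorem deriv_weight (h : RegularWeight lam c η) {u : ℝ} (hu : u ∈ Ioo η (1 - η)) :
    deriv lam u = iteratedDerivWithin 1 lam (Icc η (1 - η)) u := (h.hasDerivAt_weight hu).deriv

theorem hasDerivAt_deriv_weight (h : RegularWeight lam c η) {u : ℝ} (hu : u ∈ Ioo η (1 - η)) :
    HasDerivAt (deriv lam) (iteratedDerivWithin 2 lam (Icc η (1 - η)) u) u :=
  (h.hasDerivAt_iteratedDerivWithin (k := 1) (by norm_num) hu).congr_of_eventuallyEq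
    (Filter.eventuallyEq_of_mem (Ioo_mem_nhds hu.1 hu.2) fun _ hv => h.deriv_weight hv)

theorem abs_deriv_weight_le (h : RegularWeight lam c η) {u : ℝ} (hu : u ∈ Ioo η (1 - η)) :
    |deriv lam u| ≤ c⁻¹ := by
  rw [h.deriv_weight hu]
  exact h.abs_iteratedDerivWithin_le (by norm_num) (Ioo_subset_Icc_self hu)

theorem abs_iteratedDerivWithin_sub_le (h : RegularWeight lam c η) {k : ℕ} (hk : k < 3) {u v : ℝ}
    (hu : u ∈ Ioo η (1 - η)) (hv : v ∈ Ioo η (1 - η)) :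
    |iteratedDerivWithin k lam (Icc η (1 - η)) u - iteratedDerivWithin k lam (Icc η (1 - η)) v|
      ≤ c⁻¹ * |u - v| :=
  (convex_Ioo η (1 - η)).norm_image_sub_le_of_norm_hasDerivWithin_le
    (fun _ hw => (h.hasDerivAt_iteratedDerivWithin hk hw).hasDerivWithinAt)
    (fun _ hw => h.abs_iteratedDerivWithin_le hk (Ioo_subset_Icc_self hw)) hv hu

theorem abs_weight_sub_le (h : RegularWeight lam c η) {u v : ℝ}
    (hu : u ∈ Ioo η (1 - η)) (hv : v ∈ Ioo η (1 - η)) :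
    |lam u - lam v| ≤ c⁻¹ * |u - v| := by
  simpa using h.abs_iteratedDerivWithin_sub_le (k := 0) (by norm_num) hu hv

theorem abs_deriv_weight_sub_le (h : RegularWeight lam c η) {u v : ℝ}
    (hu : u ∈ Ioo η (1 - η)) (hv : v ∈ Ioo η (1 - η)) :
    |deriv lam u - deriv lam v| ≤ c⁻¹ * |u - v| := by
  rw [h.deriv_weight hu, h.deriv_weight hv]
  exact h.abs_iteratedDerivWithin_sub_le (by norm_num) hu hv

/-- The second derivative of a regular weight exists, is bounded by `c⁻¹`, and is Lipschitz with
constant `c⁻¹`. -/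
theorem exists_second_deriv (h : RegularWeight lam c η) :
    ∃ l2 : ℝ → ℝ, ∀ u ∈ Ioo η (1 - η), HasDerivAt (deriv lam) (l2 u) u ∧ |l2 u| ≤ c⁻¹ ∧
      ∀ v ∈ Ioo η (1 - η), |l2 u - l2 v| ≤ c⁻¹ * |u - v| :=
  ⟨iteratedDerivWithin 2 lam (Icc η (1 - η)), fun _ hu => ⟨h.hasDerivAt_deriv_weight hu,
    h.abs_iteratedDerivWithin_le (by norm_num) (Ioo_subset_Icc_self hu),
    fun _ hv => h.abs_iteratedDerivWithin_sub_le (by norm_num) hu hv⟩⟩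

end RegularWeight

/-- A globally Lipschitz extension of a function which is bounded and Lipschitz on a set. -/
theorem exists_lipschitz_extension_mem_Icc {s : Set ℝ} {f : ℝ → ℝ} {K : ℝ≥0} {a b : ℝ}
    (hab : a ≤ b) (hf : LipschitzOnWith K f s) (hb : ∀ u ∈ s, f u ∈ Icc a b) :
    ∃ g : ℝ → ℝ, LipschitzWith K g ∧ (∀ u, g u ∈ Icc a b) ∧ EqOn g f s := by
  obtain ⟨g, hg, hgs⟩ := hf.extend_real
  refine ⟨fun u => max a (min (g u) b), (hg.min_const b).const_max a,
    fun u => ⟨le_max_left _ _, max_le hab (min_le_right _ _)⟩, fun u hu => ?_⟩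
  have := hb u hu
  simp only [← hgs hu]
  rw [min_eq_left this.2, max_eq_right this.1]

/-- Bounded Lipschitz functions on the line that agree with `lam` and its derivative on every
interval on which `lam` is regular. -/
structure IsWeightExtension (lam : ℝ → ℝ) (c : ℝ) (g0 g1 : ℝ → ℝ) : Prop where
  lipschitz_zero : ∀ u v, |g0 u - g0 v| ≤ c⁻¹ * |u - v|
  lipschitz_one : ∀ u v, |g1 u - g1 v| ≤ c⁻¹ * |u - v|
  le_zero : ∀ u, c ≤ g0 u
  zero_le : ∀ u, g0 u ≤ c⁻¹
  abs_one_le : ∀ u, |g1 u| ≤ c⁻¹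
  eq : ∀ η, RegularWeight lam c η → ∀ u ∈ Ioo η (1 - η), g0 u = lam u ∧ g1 u = deriv lam u

/-- A path only asserts that some margin `η` exists, and two paths may use different ones. One
extension must therefore serve every admissible margin at once. It is obtained by extending from the
union of all regular intervals and cutting off at the bounds. -/
theorem exists_isWeightExtension {lam : ℝ → ℝ} {c : ℝ} (hc : 0 < c) (hc1 : c < 1) :
    ∃ g0 g1, IsWeightExtension lam c g0 g1 := by
  -- The intervals are nested, so any two points of the union lie in a common one and the Lipschitz
  -- bounds hold on the whole union.
  set s : Set ℝ := ⋃ (η : ℝ) (_ : RegularWeight lam c η), Ioo η (1 - η)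
  have hs : ∀ u ∈ s, ∀ v ∈ s, ∃ η, RegularWeight lam c η ∧ u ∈ Ioo η (1 - η) ∧
      v ∈ Ioo η (1 - η) := by
    intro u hu v hv
    simp only [s, mem_iUnion, exists_prop] at hu hv
    obtain ⟨η, h, hu⟩ := hu
    obtain ⟨η', h', hv⟩ := hv
    rcases le_total η η' with hle | hle
    · exact ⟨η, h, hu, ⟨by linarith [hv.1], by linarith [hv.2]⟩⟩
    · exact ⟨η', h', ⟨by linarith [hu.1], by linarith [hu.2]⟩, hv⟩
  set K : ℝ≥0 := NNReal.mk c⁻¹ (by positivity)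
  have hcc : c ≤ c⁻¹ := by
    have := one_lt_inv_iff₀.2 ⟨hc, hc1⟩
    linarith
  obtain ⟨g0, h0, h0b, h0e⟩ := exists_lipschitz_extension_mem_Icc (s := s) (f := lam) (K := K)
    (a := c) (b := c⁻¹) hcc
    (LipschitzOnWith.of_dist_le_mul fun u hu v hv => by
      obtain ⟨η, h, hu, hv⟩ := hs u hu v hv
      exact h.abs_weight_sub_le hu hv)
    (fun u hu => by
      obtain ⟨η, h, hu, -⟩ := hs u hu u hu
      exact ⟨h.le_weight (Ioo_subset_Icc_self hu), h.weight_le (Ioo_subset_Icc_self hu)⟩)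
  obtain ⟨g1, h1, h1b, h1e⟩ := exists_lipschitz_extension_mem_Icc (s := s) (f := deriv lam)
    (K := K) (a := -c⁻¹) (b := c⁻¹) (by linarith)
    (LipschitzOnWith.of_dist_le_mul fun u hu v hv => by
      obtain ⟨η, h, hu, hv⟩ := hs u hu v hv
      exact h.abs_deriv_weight_sub_le hu hv)
    (fun u hu => by
      obtain ⟨η, h, hu, -⟩ := hs u hu u hu
      exact abs_le.1 (h.abs_deriv_weight_le hu))
  refine ⟨g0, g1, fun u v => h0.dist_le_mul u v, fun u v => h1.dist_le_mul u v,
    fun u => (h0b u).1, fun u => (h0b u).2, fun u => abs_le.2 (h1b u), fun η h u hu => ?_⟩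
  have : u ∈ s := by
    simp only [s, mem_iUnion, exists_prop]
    exact ⟨η, h, hu⟩
  exact ⟨h0e this, h1e this⟩

/-! ### Calculus of bounded Lipschitz functionals. -/

/-- `f` is bounded by `B` and Lipschitz with constant `B * M`. -/
structure BddLip {E : Type*} [PseudoMetricSpace E] (f : E → ℝ) (B M : ℝ) : Prop where
  bound_nonneg : 0 ≤ B
  nonneg : 0 ≤ M
  bound : ∀ x, |f x| ≤ B
  lip : ∀ x y, |f x - f y| ≤ B * M * dist x y

namespace BddLip

variable {E : Type*} [PseudoMetricSpace E] {f g : E → ℝ} {B C M N : ℝ}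

theorem mono (hf : BddLip f B M) (hB : B ≤ C) (hM : M ≤ N) : BddLip f C N where
  bound_nonneg := hf.bound_nonneg.trans hB
  nonneg := hf.nonneg.trans hM
  bound x := (hf.bound x).trans hB
  lip x y := by
    have h0 := hf.bound_nonneg
    have hM0 := hf.nonneg
    have hC := h0.trans hB
    exact (hf.lip x y).trans (by gcongr)

/-- With the Lipschitz constant measured relative to the bound, products multiply the bounds and add
the relative constants, as for logarithmic derivatives. -/
theorem mul (hf : BddLip f B M) (hg : BddLip g C N) :
    BddLip (fun x => f x * g x) (B * C) (M + N) where
  bound_nonneg := mul_nonneg hf.bound_nonneg hg.bound_nonneg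
  nonneg := add_nonneg hf.nonneg hg.nonneg
  bound x := by
    rw [abs_mul]
    exact mul_le_mul (hf.bound x) (hg.bound x) (abs_nonneg _) ((abs_nonneg _).trans (hf.bound x))
  lip x y := by
    have hB : 0 ≤ B := (abs_nonneg _).trans (hf.bound x)
    have hM := hf.nonneg
    calc |f x * g x - f y * g y| = |(f x - f y) * g x + f y * (g x - g y)| := by ring_nf
      _ ≤ |f x - f y| * |g x| + |f y| * |g x - g y| := by
          rw [← abs_mul, ← abs_mul]; exact abs_add_le _ _
      _ ≤ (B * M * dist x y) * C + B * (C * N * dist x y) := by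
          gcongr
          exacts [hf.lip x y, hg.bound x, hf.bound y, hg.lip x y]
      _ = B * C * (M + N) * dist x y := by ring

theorem sub (hf : BddLip f B M) (hg : BddLip g C M) : BddLip (fun x => f x - g x) (B + C) M where
  bound_nonneg := add_nonneg hf.bound_nonneg hg.bound_nonneg
  nonneg := hf.nonneg
  bound x := (abs_sub _ _).trans (add_le_add (hf.bound x) (hg.bound x))
  lip x y := by
    calc |f x - g x - (f y - g y)| = |(f x - f y) - (g x - g y)| := by ring_nf
      _ ≤ |f x - f y| + |g x - g y| := abs_sub _ _
      _ ≤ B * M * dist x y + C * M * dist x y := add_le_add (hf.lip x y) (hg.lip x y)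
      _ = (B + C) * M * dist x y := by ring

theorem neg (hf : BddLip f B M) : BddLip (fun x => -f x) B M where
  bound_nonneg := hf.bound_nonneg
  nonneg := hf.nonneg
  bound x := by rw [abs_neg]; exact hf.bound x
  lip x y := by rw [← abs_neg]; simpa [sub_eq_add_neg, add_comm] using hf.lip x y

theorem inv (hf : BddLip f B M) {m : ℝ} (hm : 0 < m) (h : ∀ x, m ≤ f x) :
    BddLip (fun x => (f x)⁻¹) m⁻¹ (B * m⁻¹ * M) := by
  have hpos : ∀ x, 0 < f x := fun x => hm.trans_le (h x)
  constructor
  · positivity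
  · have := hf.bound_nonneg
    have := hf.nonneg
    positivity
  · intro x
    rw [abs_of_pos (inv_pos.2 (hpos x))]
    exact inv_anti₀ hm (h x)
  · intro x y
    have hx := hpos x
    have hy := hpos y
    have h0 : 0 ≤ B := (abs_nonneg _).trans (hf.bound x)
    have hM := hf.nonneg
    have : (f x)⁻¹ - (f y)⁻¹ = -(f x - f y) * ((f x)⁻¹ * (f y)⁻¹) := by
      field_simp
      ring
    rw [this, abs_mul, abs_neg, abs_of_pos (by positivity : 0 < (f x)⁻¹ * (f y)⁻¹)]
    calc |f x - f y| * ((f x)⁻¹ * (f y)⁻¹) ≤ (B * M * dist x y) * (m⁻¹ * m⁻¹) := by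
          gcongr
          exacts [hf.lip x y, h x, h y]
      _ = m⁻¹ * (B * m⁻¹ * M) * dist x y := by ring

theorem one_sub (hf : BddLip f 1 M) (h : ∀ x, f x ∈ Icc (0 : ℝ) 1) :
    BddLip (fun x => 1 - f x) 1 M where
  bound_nonneg := hf.bound_nonneg
  nonneg := hf.nonneg
  bound x := abs_le.2 ⟨by linarith [(h x).2], by linarith [(h x).1]⟩
  lip x y := by
    have : 1 - f x - (1 - f y) = -(f x - f y) := by ring
    rw [this, abs_neg]
    exact hf.lip x y

theorem average {n : ℕ} (hn : 0 < n) {f : Fin n → E → ℝ} (hf : ∀ i, BddLip (f i) B M) :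
    BddLip (fun x => (1 / (n : ℝ)) * ∑ i, f i x) B M where
  bound_nonneg := (hf ⟨0, hn⟩).bound_nonneg
  nonneg := (hf ⟨0, hn⟩).nonneg
  bound x := by
    have hn' : (0 : ℝ) < n := by exact_mod_cast hn
    rw [abs_mul, abs_of_pos (by positivity : (0 : ℝ) < 1 / n)]
    calc 1 / (n : ℝ) * |∑ i, f i x| ≤ 1 / (n : ℝ) * ∑ _i : Fin n, B := by
          gcongr
          exact (Finset.abs_sum_le_sum_abs _ _).trans
            (Finset.sum_le_sum fun i _ => (hf i).bound x)
      _ = B := by simp; field_simp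
  lip x y := by
    have hn' : (0 : ℝ) < n := by exact_mod_cast hn
    rw [← mul_sub, ← Finset.sum_sub_distrib, abs_mul,
      abs_of_pos (by positivity : (0 : ℝ) < 1 / n)]
    calc 1 / (n : ℝ) * |∑ i, (f i x - f i y)|
        ≤ 1 / (n : ℝ) * ∑ _i : Fin n, B * M * dist x y := by
          gcongr
          exact (Finset.abs_sum_le_sum_abs _ _).trans
            (Finset.sum_le_sum fun i _ => (hf i).lip x y)
      _ = B * M * dist x y := by simp; field_simp

end BddLip

/-! ### The truncated vector field and its bounds. -/

/-- Truncation of a real number to `[a, b]`. -/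
noncomputable def clamp (a b u : ℝ) : ℝ := max a (min u b)

theorem clamp_mem {a b : ℝ} (hab : a ≤ b) (u : ℝ) : clamp a b u ∈ Icc a b :=
  ⟨le_max_left _ _, max_le hab (min_le_right _ _)⟩

theorem clamp_of_mem {a b u : ℝ} (hu : u ∈ Icc a b) : clamp a b u = u := by
  rw [clamp, min_eq_left hu.2, max_eq_right hu.1]

theorem abs_clamp_sub_le (a b u v : ℝ) : |clamp a b u - clamp a b v| ≤ |u - v| := by
  simpa [Real.dist_eq, clamp] using ((LipschitzWith.id.min_const b).const_max a).dist_le_mul u v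

theorem continuous_clamp (a b : ℝ) : Continuous (clamp a b) := by
  unfold clamp
  fun_prop

section FieldComponents

variable {K : Type*} [TopologicalSpace K]

/-- Triples of continuous functions on a compact space. -/
abbrev Triple (K : Type*) [TopologicalSpace K] : Type _ := C(K, ℝ) × C(K, ℝ) × C(K, ℝ)

variable {n : ℕ} (g0 g1 : ℝ → ℝ) (c : ℝ) (x : Fin n → K)

/-- The empirical normalization. -/
noncomputable def sampleOmega (U : Triple K) : ℝ := (1 / (n : ℝ)) * ∑ j, g0 (U.2.2 (x j))

/-- The truncated contrast. -/
noncomputable def clampTau (U : Triple K) (k : K) : ℝ := clamp 0 1 (U.1 k) - clamp 0 1 (U.2.1 k)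

/-- The empirical weighted contrast. -/
noncomputable def samplePsi (U : Triple K) : ℝ :=
  (1 / (n : ℝ)) * (∑ j, g0 (U.2.2 (x j)) * clampTau U (x j)) * (sampleOmega g0 x U)⁻¹

/-- First component of the truncated vector field. -/
noncomputable def field1 (U : Triple K) (k : K) : ℝ :=
  clamp 0 1 (U.1 k) * (1 - clamp 0 1 (U.1 k)) * g0 (U.2.2 k) *
    (sampleOmega g0 x U)⁻¹ * (clamp c (1 - c) (U.2.2 k))⁻¹

/-- Second component of the truncated vector field. -/
noncomputable def field0 (U : Triple K) (k : K) : ℝ :=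
  -(clamp 0 1 (U.2.1 k) * (1 - clamp 0 1 (U.2.1 k)) * g0 (U.2.2 k) *
    (sampleOmega g0 x U)⁻¹ * (1 - clamp c (1 - c) (U.2.2 k))⁻¹)

/-- Third component of the truncated vector field. -/
noncomputable def fielde (U : Triple K) (k : K) : ℝ :=
  clamp c (1 - c) (U.2.2 k) * (1 - clamp c (1 - c) (U.2.2 k)) * g1 (U.2.2 k) *
    (sampleOmega g0 x U)⁻¹ * (clampTau U k - samplePsi g0 x U)

end FieldComponents

theorem IsWeightExtension.le_sampleOmega {K : Type*} [TopologicalSpace K] {n : ℕ} {g0 g1 : ℝ → ℝ}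
    {c : ℝ} {x : Fin n → K} {lam : ℝ → ℝ} (hg : IsWeightExtension lam c g0 g1) (hn : 0 < n) (U : Triple K) :
    c ≤ sampleOmega g0 x U := by
  have hn' : (0 : ℝ) < n := by exact_mod_cast hn
  calc c = 1 / (n : ℝ) * ∑ _j : Fin n, c := by simp; field_simp
    _ ≤ _ := by
      unfold sampleOmega
      gcongr
      exact hg.le_zero _

section VectorField

variable {K : Type*} [TopologicalSpace K] [CompactSpace K] {n : ℕ} {g0 g1 : ℝ → ℝ} {c : ℝ}
  {x : Fin n → K} {lam : ℝ → ℝ}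

theorem abs_fst_sub_le (U W : Triple K) (k : K) : |U.1 k - W.1 k| ≤ dist U W :=
  (ContinuousMap.dist_apply_le_dist (f := U.1) (g := W.1) k).trans (le_max_left _ _)

theorem abs_snd_fst_sub_le (U W : Triple K) (k : K) : |U.2.1 k - W.2.1 k| ≤ dist U W :=
  (ContinuousMap.dist_apply_le_dist (f := U.2.1) (g := W.2.1) k).trans ((le_max_left _ _).trans (le_max_right _ _))

theorem abs_snd_snd_sub_le (U W : Triple K) (k : K) : |U.2.2 k - W.2.2 k| ≤ dist U W :=
  (ContinuousMap.dist_apply_le_dist (f := U.2.2) (g := W.2.2) k).trans ((le_max_right _ _).trans (le_max_right _ _))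

theorem bddLip_clamp {a b : ℝ} (h0 : 0 ≤ a) (hab : a ≤ b) (hb : b ≤ 1) {E : Type*}
    [PseudoMetricSpace E] {f : E → ℝ} (hf : ∀ u w, |f u - f w| ≤ dist u w) :
    BddLip (fun U => clamp a b (f U)) 1 1 where
  bound_nonneg := zero_le_one
  nonneg := zero_le_one
  bound U := by
    have := clamp_mem hab (f U)
    exact abs_le.2 ⟨by linarith [this.1], this.2.trans hb⟩
  lip U W := by simpa using (abs_clamp_sub_le a b _ _).trans (hf U W)

theorem bddLip_weight_comp {g : ℝ → ℝ} {z : ℝ} (hg : ∀ u, |g u| ≤ z)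
    (hl : ∀ u v, |g u - g v| ≤ z * |u - v|) (k : K) :
    BddLip (fun U : Triple K => g (U.2.2 k)) z 1 where
  bound_nonneg := (abs_nonneg _).trans (hg 0)
  nonneg := zero_le_one
  bound U := hg _
  lip U W := by
    have hz : 0 ≤ z := (abs_nonneg _).trans (hg 0)
    calc |g (U.2.2 k) - g (W.2.2 k)| ≤ z * |U.2.2 k - W.2.2 k| := hl _ _
      _ ≤ z * 1 * dist U W := by
        rw [mul_one]
        gcongr
        exact abs_snd_snd_sub_le U W k

namespace IsWeightExtension

theorem bddLip_zero (hg : IsWeightExtension lam c g0 g1) (hc : 0 < c) (k : K) :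
    BddLip (fun U : Triple K => g0 (U.2.2 k)) c⁻¹ 1 :=
  bddLip_weight_comp (fun u => abs_le.2 ⟨by
    have := hg.le_zero u
    have : 0 < c⁻¹ := by positivity
    linarith, hg.zero_le u⟩) hg.lipschitz_zero k

theorem bddLip_one (hg : IsWeightExtension lam c g0 g1) (k : K) :
    BddLip (fun U : Triple K => g1 (U.2.2 k)) c⁻¹ 1 :=
  bddLip_weight_comp hg.abs_one_le hg.lipschitz_one k

theorem bddLip_inv_sampleOmega (hg : IsWeightExtension lam c g0 g1) (hc : 0 < c) (hn : 0 < n) :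
    BddLip (fun U : Triple K => (sampleOmega g0 x U)⁻¹) c⁻¹ (c⁻¹ ^ 2) :=
  ((BddLip.average hn fun j => hg.bddLip_zero hc (x j)).inv hc
    (fun U => hg.le_sampleOmega hn U)).mono le_rfl (by rw [mul_one, sq])

end IsWeightExtension

theorem bddLip_clamp_fst (k : K) : BddLip (fun U : Triple K => clamp 0 1 (U.1 k)) 1 1 :=
  bddLip_clamp le_rfl zero_le_one le_rfl fun U W => abs_fst_sub_le U W k

theorem bddLip_clamp_snd_fst (k : K) : BddLip (fun U : Triple K => clamp 0 1 (U.2.1 k)) 1 1 :=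
  bddLip_clamp le_rfl zero_le_one le_rfl fun U W => abs_snd_fst_sub_le U W k

theorem bddLip_clamp_snd_snd (hc : 0 < c) (hc4 : c < 1 / 4) (k : K) :
    BddLip (fun U : Triple K => clamp c (1 - c) (U.2.2 k)) 1 1 :=
  bddLip_clamp hc.le (by linarith) (by linarith) fun U W => abs_snd_snd_sub_le U W k

theorem bddLip_clampTau (k : K) : BddLip (fun U : Triple K => clampTau U k) 2 1 :=
  ((bddLip_clamp_fst k).sub (bddLip_clamp_snd_fst k)).mono (by norm_num) le_rfl

namespace IsWeightExtension

theorem bddLip_samplePsi (hg : IsWeightExtension lam c g0 g1) (hc : 0 < c) (hn : 0 < n) :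
    BddLip (fun U : Triple K => samplePsi g0 x U) (2 * c⁻¹ ^ 2) (c⁻¹ ^ 2 + 2) :=
  ((BddLip.average hn fun j => (hg.bddLip_zero hc (x j)).mul (bddLip_clampTau (x j))).mul
    (hg.bddLip_inv_sampleOmega hc hn)).mono (by ring_nf; rfl) (by ring_nf; rfl)

theorem bddLip_field1 (hg : IsWeightExtension lam c g0 g1) (hc : 0 < c) (hc4 : c < 1 / 4)
    (hn : 0 < n) (k : K) :
    BddLip (fun U : Triple K => field1 g0 c x U k) (3 * c⁻¹ ^ 4) (3 * c⁻¹ ^ 2) := by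
  have h1 := bddLip_clamp_fst (K := K) k
  have h2 := bddLip_clamp_snd_snd hc hc4 k
  have hz : 4 ≤ c⁻¹ := by
    rw [le_inv_comm₀ (by norm_num) hc]; linarith
  refine ((((h1.mul (h1.one_sub fun U => clamp_mem zero_le_one _)).mul (hg.bddLip_zero hc k)).mul
    (hg.bddLip_inv_sampleOmega (x := x) hc hn)).mul
    (h2.inv hc fun U => (clamp_mem (by linarith) _).1)).mono ?_ ?_
  · generalize c⁻¹ = z at *
    nlinarith [pow_pos (show 0 < z by linarith) 3]
  · generalize c⁻¹ = z at *
    nlinarith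

theorem bddLip_field0 (hg : IsWeightExtension lam c g0 g1) (hc : 0 < c) (hc4 : c < 1 / 4)
    (hn : 0 < n) (k : K) :
    BddLip (fun U : Triple K => field0 g0 c x U k) (3 * c⁻¹ ^ 4) (3 * c⁻¹ ^ 2) := by
  have h1 := bddLip_clamp_snd_fst (K := K) k
  have h2 := (bddLip_clamp_snd_snd hc hc4 k).one_sub fun U =>
    ⟨hc.le.trans (clamp_mem (by linarith) _).1, (clamp_mem (by linarith) _).2.trans (by linarith)⟩
  have hz : 4 ≤ c⁻¹ := by
    rw [le_inv_comm₀ (by norm_num) hc]; linarith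
  refine ((((h1.mul (h1.one_sub fun U => clamp_mem zero_le_one _)).mul (hg.bddLip_zero hc k)).mul
    (hg.bddLip_inv_sampleOmega (x := x) hc hn)).mul
    (h2.inv hc fun U => by
      have := (clamp_mem (show c ≤ 1 - c by linarith) (U.2.2 k)).2
      linarith)).neg.mono ?_ ?_
  · generalize c⁻¹ = z at *
    nlinarith [pow_pos (show 0 < z by linarith) 3]
  · generalize c⁻¹ = z at *
    nlinarith

theorem bddLip_fielde (hg : IsWeightExtension lam c g0 g1) (hc : 0 < c) (hc4 : c < 1 / 4)
    (hn : 0 < n) (k : K) :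
    BddLip (fun U : Triple K => fielde g0 g1 c x U k) (3 * c⁻¹ ^ 4) (3 * c⁻¹ ^ 2) := by
  have h2 := bddLip_clamp_snd_snd hc hc4 k
  have h3 := h2.one_sub fun U =>
    ⟨hc.le.trans (clamp_mem (by linarith) _).1, (clamp_mem (by linarith) _).2.trans (by linarith)⟩
  have hz : 4 ≤ c⁻¹ := by
    rw [le_inv_comm₀ (by norm_num) hc]; linarith
  -- With `z = c⁻¹`, the product has bound `2z² + 2z⁴` and relative constant `5 + 2z²`. This
  -- component dictates the common constants `3z⁴` and `3z²` used for all three.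
  refine ((((h2.mul h3).mul (hg.bddLip_one k)).mul
    (hg.bddLip_inv_sampleOmega (x := x) hc hn)).mul
    (((bddLip_clampTau k).mono le_rfl (by nlinarith)).sub
      (hg.bddLip_samplePsi (x := x) hc hn))).mono ?_ ?_
  · generalize c⁻¹ = z at *
    nlinarith [mul_nonneg (sq_nonneg z) (show 0 ≤ z ^ 2 - 2 by nlinarith)]
  · generalize c⁻¹ = z at *
    nlinarith

end IsWeightExtension

/-- The truncated vector field on triples of continuous functions. -/
noncomputable def truncField (hg : IsWeightExtension lam c g0 g1) (hc : 0 < c) (hc4 : c < 1 / 4)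
    (x : Fin n → K) (U : Triple K) : Triple K :=
  have h0 : Continuous g0 := (LipschitzWith.of_dist_le_mul (K := NNReal.mk c⁻¹ (by positivity))
    fun u v => hg.lipschitz_zero u v).continuous
  have h1 : Continuous g1 := (LipschitzWith.of_dist_le_mul (K := NNReal.mk c⁻¹ (by positivity))
    fun u v => hg.lipschitz_one u v).continuous
  have h2 := continuous_clamp 0 1
  have h3 : Continuous fun k => clamp c (1 - c) (U.2.2 k) :=
    (continuous_clamp c (1 - c)).comp U.2.2.continuous
  have h4 : ∀ k, clamp c (1 - c) (U.2.2 k) ≠ 0 := fun k =>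
    (hc.trans_le (clamp_mem (by linarith) _).1).ne'
  have h5 : ∀ k, 1 - clamp c (1 - c) (U.2.2 k) ≠ 0 := fun k => by
    have := (clamp_mem (show c ≤ 1 - c by linarith) (U.2.2 k)).2
    exact (by linarith : 0 < 1 - clamp c (1 - c) (U.2.2 k)).ne'
  (⟨field1 g0 c x U, by
      unfold field1
      exact Continuous.mul (by fun_prop) (h3.inv₀ h4)⟩,
    ⟨field0 g0 c x U, by
      unfold field0
      exact (Continuous.mul (by fun_prop) ((continuous_const.sub h3).inv₀ h5)).neg⟩,
    ⟨fielde g0 g1 c x U, by unfold fielde clampTau; fun_prop⟩)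

section truncField

variable (hg : IsWeightExtension lam c g0 g1) (hc : 0 < c) (hc4 : c < 1 / 4)

theorem lipschitzWith_truncField (hn : 0 < n) :
    LipschitzWith (NNReal.mk (9 * c⁻¹ ^ 6) (by positivity)) (truncField hg hc hc4 x) := by
  refine LipschitzWith.of_dist_le_mul fun U W => ?_
  have h : 3 * c⁻¹ ^ 4 * (3 * c⁻¹ ^ 2) = 9 * c⁻¹ ^ 6 := by ring
  rw [NNReal.coe_mk, ← h]
  have h0 : 0 ≤ 3 * c⁻¹ ^ 4 * (3 * c⁻¹ ^ 2) * dist U W := by positivity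
  refine max_le ?_ (max_le ?_ ?_)
  · exact (ContinuousMap.dist_le h0).2 fun k => (hg.bddLip_field1 hc hc4 hn k).lip U W
  · exact (ContinuousMap.dist_le h0).2 fun k => (hg.bddLip_field0 hc hc4 hn k).lip U W
  · exact (ContinuousMap.dist_le h0).2 fun k => (hg.bddLip_fielde hc hc4 hn k).lip U W

theorem norm_truncField_le (hn : 0 < n) (U : Triple K) :
    ‖truncField hg hc hc4 x U‖ ≤ 3 * c⁻¹ ^ 4 := by
  have h0 : 0 ≤ 3 * c⁻¹ ^ 4 := by positivity
  refine max_le ?_ (max_le ?_ ?_)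
  · exact (ContinuousMap.norm_le _ h0).2 fun k => (hg.bddLip_field1 hc hc4 hn k).bound U
  · exact (ContinuousMap.norm_le _ h0).2 fun k => (hg.bddLip_field0 hc hc4 hn k).bound U
  · exact (ContinuousMap.norm_le _ h0).2 fun k => (hg.bddLip_fielde hc hc4 hn k).bound U

end truncField

end VectorField

/-! ### Empirical functionals, and existence and uniqueness of the path. -/

section Empirical

variable {d n : ℕ} (x : Fin n → Cov d)

theorem integral_empirical (f : Cov d → ℝ) :
    ∫ y, f y ∂(empirical x) = (1 / (n : ℝ)) * ∑ i, f (x i) := by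
  rw [empirical, integral_smul_measure, integral_finsetSum_measure]
  · simp [integral_dirac]
  · intro i _
    exact integrable_dirac (by simp)

theorem Omega_empirical (lam : ℝ → ℝ) (U : Nuis d) :
    Omega lam (empirical x) U = (1 / (n : ℝ)) * ∑ i, lam (U.2.2 (x i)) :=
  integral_empirical x _

theorem psi_empirical (lam : ℝ → ℝ) (U : Nuis d) :
    psi lam (empirical x) U = (1 / (n : ℝ)) * (∑ i, lam (U.2.2 (x i)) *
      (U.1 (x i) - U.2.1 (x i))) * ((1 / (n : ℝ)) * ∑ i, lam (U.2.2 (x i)))⁻¹ := by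
  rw [psi, Omega_empirical, integral_empirical, div_eq_mul_inv]
  rfl

end Empirical

section Path

variable {d n : ℕ} {lam g0 g1 : ℝ → ℝ} {c η : ℝ} {U0 : Nuis d} {x : Fin n → Cov d}

theorem Positivity.regularWeight (h : Positivity lam U0 η) (hc : IsRegConst lam η c) :
    RegularWeight lam c η :=
  ⟨hc.1.1, h.1, h.2.2.1, hc⟩

/-- Shifting `U` by the constants `±η` stays in the `2η`-ball, where values lie in `[η, 1-η]`. The
margin gained keeps the values in the open interval, where derivatives of `lam` are two-sided. -/
theorem Positivity.valuesIn (h : Positivity lam U0 η) {U : Nuis d} (hU : ‖U - U0‖ ≤ η) :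
    ValuesIn U (Icc (2 * η) (1 - 2 * η)) := by
  have hη := h.1.1
  have key : ∀ s : ℝ, |s| ≤ η → ∀ y, (U.1 y + s ∈ Icc η (1 - η)) ∧ (U.2.1 y + s ∈ Icc η (1 - η)) ∧
      (U.2.2 y + s ∈ Icc η (1 - η)) := by
    intro s hs y
    have hconst : ‖((ContinuousMap.const (Cov d) s, ContinuousMap.const (Cov d) s,
        ContinuousMap.const (Cov d) s) : Nuis d)‖ ≤ η := by
      have : ‖ContinuousMap.const (Cov d) s‖ ≤ η :=
        (ContinuousMap.norm_le _ hη.le).2 fun _ => by simpa using hs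
      exact max_le this (max_le this this)
    refine h.2.1 (U + (ContinuousMap.const (Cov d) s, ContinuousMap.const (Cov d) s,
      ContinuousMap.const (Cov d) s)) ?_ y
    rw [add_sub_right_comm, two_mul]
    exact (norm_add_le _ _).trans (add_le_add hU hconst)
  intro y
  obtain ⟨a1, a2, a3⟩ := key η (abs_of_pos hη).le y
  obtain ⟨b1, b2, b3⟩ := key (-η) (by rw [abs_neg, abs_of_pos hη]) y
  simp only [mem_Icc] at a1 a2 a3 b1 b2 b3
  exact ⟨⟨by change _ ≤ U.1 y; linarith, by change U.1 y ≤ _; linarith⟩,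
    ⟨by change _ ≤ U.2.1 y; linarith, by change U.2.1 y ≤ _; linarith⟩,
    ⟨by change _ ≤ U.2.2 y; linarith, by change U.2.2 y ≤ _; linarith⟩⟩

section Agreement

variable {U : Nuis d}

/-- The values of the triple `U` lie well inside an interval on which `lam` is regular. -/
structure RegularAt (lam : ℝ → ℝ) (c η : ℝ) (U : Nuis d) : Prop where
  regular : RegularWeight lam c η
  values : ValuesIn U (Icc (2 * η) (1 - 2 * η))

namespace RegularAt

theorem ps_mem (h : RegularAt lam c η U) (y : Cov d) : U.2.2 y ∈ Ioo η (1 - η) := by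
  have := (h.values y).2.2
  have h0 := h.regular.mem.1
  exact ⟨by have := this.1; simp only [ps] at this; linarith,
    by have := this.2; simp only [ps] at this; linarith⟩

theorem clamp_ps (h : RegularAt lam c η U) (y : Cov d) :
    clamp c (1 - c) (U.2.2 y) = U.2.2 y := by
  have := h.ps_mem y
  have hc := h.regular.le_margin
  exact clamp_of_mem ⟨by linarith [this.1], by linarith [this.2]⟩

theorem q1_mem (h : RegularAt lam c η U) (y : Cov d) : U.1 y ∈ Icc (0 : ℝ) 1 := by
  have := (h.values y).1
  have h0 := h.regular.mem.1
  exact ⟨by have := this.1; simp only [q1] at this; linarith,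
    by have := this.2; simp only [q1] at this; linarith⟩

theorem q0_mem (h : RegularAt lam c η U) (y : Cov d) : U.2.1 y ∈ Icc (0 : ℝ) 1 := by
  have := (h.values y).2.1
  have h0 := h.regular.mem.1
  exact ⟨by have := this.1; simp only [q0] at this; linarith,
    by have := this.2; simp only [q0] at this; linarith⟩

theorem sampleOmega_eq (h : RegularAt lam c η U) (hg : IsWeightExtension lam c g0 g1) :
    sampleOmega g0 x U = Omega lam (empirical x) U := by
  rw [Omega_empirical, sampleOmega]
  simp only [(hg.eq η h.regular _ (h.ps_mem _)).1]

theorem clampTau_eq (h : RegularAt lam c η U) (y : Cov d) : clampTau U y = tau U y := by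
  rw [clampTau, clamp_of_mem (h.q1_mem y), clamp_of_mem (h.q0_mem y)]
  rfl

theorem samplePsi_eq (h : RegularAt lam c η U) (hg : IsWeightExtension lam c g0 g1) :
    samplePsi g0 x U = psi lam (empirical x) U := by
  rw [psi_empirical, ← Omega_empirical, samplePsi, h.sampleOmega_eq hg]
  simp only [(hg.eq η h.regular _ (h.ps_mem _)).1, h.clampTau_eq]
  rfl

theorem field1_eq (h : RegularAt lam c η U) (hg : IsWeightExtension lam c g0 g1) (y : Cov d) :
    field1 g0 c x U y = F1 lam (empirical x) U y := by
  rw [field1, F1, h.sampleOmega_eq hg, clamp_of_mem (h.q1_mem y), h.clamp_ps,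
    (hg.eq η h.regular _ (h.ps_mem y)).1, div_eq_mul_inv, mul_inv, ← mul_assoc]
  rfl

theorem field0_eq (h : RegularAt lam c η U) (hg : IsWeightExtension lam c g0 g1) (y : Cov d) :
    field0 g0 c x U y = F0 lam (empirical x) U y := by
  rw [field0, F0, h.sampleOmega_eq hg, clamp_of_mem (h.q0_mem y), h.clamp_ps,
    (hg.eq η h.regular _ (h.ps_mem y)).1, div_eq_mul_inv, mul_inv, ← mul_assoc]
  rfl

theorem fielde_eq (h : RegularAt lam c η U) (hg : IsWeightExtension lam c g0 g1) (y : Cov d) :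
    fielde g0 g1 c x U y = Fe lam (empirical x) U y := by
  rw [fielde, Fe, h.sampleOmega_eq hg, h.clamp_ps, h.clampTau_eq, h.samplePsi_eq hg,
    (hg.eq η h.regular _ (h.ps_mem y)).2, div_eq_mul_inv]
  rfl

end RegularAt

end Agreement

theorem t1_pos (hc : 0 < c) : 0 < t1 c := by
  unfold t1
  positivity

theorem IsPath.exists_regularAt {U : ℝ → Nuis d} (h : IsPath lam (empirical x) U0 c U) :
    ∃ η, Positivity lam U0 η ∧ IsRegConst lam η c ∧
      ∀ t ∈ Ioo (-t1 c) (t1 c), RegularAt lam c η (U t) := by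
  obtain ⟨-, -, -, η, hp, hr, hU⟩ := h
  exact ⟨η, hp, hr, fun t ht => ⟨hp.regularWeight hr, hp.valuesIn (hU t ht)⟩⟩

/-- Inside the ball the truncations act as the identity, so every solution of the original equation
also solves the globally Lipschitz one. Uniqueness follows from this. -/
theorem IsPath.hasDerivAt (hg : IsWeightExtension lam c g0 g1) (hc : 0 < c) (hc4 : c < 1 / 4)
    {U : ℝ → Nuis d} (h : IsPath lam (empirical x) U0 c U) :
    ∀ t ∈ Ioo (-t1 c) (t1 c), HasDerivAt U (truncField hg hc hc4 x (U t)) t := by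
  intro t ht
  obtain ⟨η, -, -, hU⟩ := h.exists_regularAt
  have hR := hU t ht
  have hd : DifferentiableAt ℝ U t :=
    (h.2.1.differentiableOn one_ne_zero).differentiableAt (Ioo_mem_nhds ht.1 ht.2)
  have hF := h.2.2.1 t ht
  have : deriv U t = truncField hg hc hc4 x (U t) := by
    refine Prod.ext ?_ (Prod.ext ?_ ?_)
    · ext y
      exact (hF y).1.trans (hR.field1_eq hg y).symm
    · ext y
      exact (hF y).2.1.trans (hR.field0_eq hg y).symm
    · ext y
      exact (hF y).2.2.trans (hR.fielde_eq hg y).symm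
  exact this ▸ hd.hasDerivAt

theorem IsPath.eqOn (hn : 0 < n) (hc : 0 < c) (hc4 : c < 1 / 4)
    {U W : ℝ → Nuis d} (hU : IsPath lam (empirical x) U0 c U)
    (hW : IsPath lam (empirical x) U0 c W) : EqOn U W (Ioo (-t1 c) (t1 c)) := by
  obtain ⟨g0, g1, hg⟩ := exists_isWeightExtension (lam := lam) hc (by linarith)
  intro t ht
  have := dist_solution_le (lipschitzWith_truncField (x := x) hg hc hc4 hn)
    (hU.hasDerivAt hg hc hc4) (hW.hasDerivAt hg hc hc4) ht
  rw [hU.1, hW.1, dist_self, zero_mul] at this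
  exact dist_le_zero.1 this

theorem exists_isPath (hn : 0 < n) (hp : Positivity lam U0 η) (hr : IsRegConst lam η c) :
    ∃ U, IsPath lam (empirical x) U0 c U := by
  have hw := hp.regularWeight hr
  have hc := hw.pos
  have hc4 := hw.lt_quarter
  obtain ⟨g0, g1, hg⟩ := exists_isWeightExtension (lam := lam) hc (by linarith)
  have hlip := lipschitzWith_truncField (x := x) hg hc hc4 hn
  obtain ⟨U, hU0, hU⟩ := exists_solution_of_lipschitz_of_bounded
    (V := NNReal.mk (3 * c⁻¹ ^ 4) (by positivity)) hlip
    (norm_truncField_le (x := x) hg hc hc4 hn) (t1_pos hc) U0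
  have h0 : (0 : ℝ) ∈ Ioo (-t1 c) (t1 c) := ⟨by linarith [t1_pos hc], t1_pos hc⟩
  have hball : ∀ t ∈ Ioo (-t1 c) (t1 c), ‖U t - U0‖ ≤ η := by
    intro t ht
    have h1 := norm_solution_sub_le (norm_truncField_le (x := x) hg hc hc4 hn) hU h0 ht
    rw [hU0, sub_zero] at h1
    have h2 : |t| ≤ t1 c := abs_le.2 ⟨ht.1.le, ht.2.le⟩
    -- Speed times horizon is `3c²/8 < c ≤ η`: the trajectory stays where the truncated and the
    -- original fields agree.
    calc ‖U t - U0‖ ≤ 3 * c⁻¹ ^ 4 * |t| := h1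
      _ ≤ 3 * c⁻¹ ^ 4 * (c ^ 6 / 8) := by gcongr; exact h2
      _ = 3 / 8 * c ^ 2 := by field_simp
      _ ≤ c := by nlinarith
      _ ≤ η := hw.le_margin
  have hR : ∀ t ∈ Ioo (-t1 c) (t1 c), RegularAt lam c η (U t) := fun t ht =>
    ⟨hw, hp.valuesIn (hball t ht)⟩
  have hcont : ContinuousOn U (Ioo (-t1 c) (t1 c)) := fun t ht =>
    (hU t ht).continuousAt.continuousWithinAt
  refine ⟨U, hU0, ?_, fun t ht y => ?_, η, hp, hr, hball⟩
  · rw [show (1 : WithTop ℕ∞) = 0 + 1 from (zero_add 1).symm,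
      contDiffOn_succ_iff_deriv_of_isOpen isOpen_Ioo]
    refine ⟨fun t ht => (hU t ht).differentiableAt.differentiableWithinAt, by simp, ?_⟩
    rw [contDiffOn_zero]
    exact (hlip.continuous.comp_continuousOn hcont).congr fun t ht => (hU t ht).deriv
  · rw [(hU t ht).deriv]
    exact ⟨(hR t ht).field1_eq hg y, (hR t ht).field0_eq hg y, (hR t ht).fielde_eq hg y⟩

theorem isPath_path (hn : 0 < n) (hp : Positivity lam U0 η) (hr : IsRegConst lam η c) :
    IsPath lam (empirical x) U0 c (path lam (empirical x) U0 c) := by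
  have h : ∃ U, IsPath lam (empirical x) U0 c U := exists_isPath hn hp hr
  rw [path, dif_pos h]
  exact h.choose_spec

end Path

/-! ### Calculus of functions of time with Lipschitz derivative. -/

/-- On `(-T, T)` the function `f` is bounded by `B`, its derivative is bounded by `B * M`, and the
derivative is Lipschitz with constant `B * (σ * M ^ 2)`. -/
structure BddC11 (T σ : ℝ) (f : ℝ → ℝ) (B M : ℝ) : Prop where
  bound_nonneg : 0 ≤ B
  nonneg : 0 ≤ M
  diff : ∀ t ∈ Ioo (-T) T, DifferentiableAt ℝ f t
  bound : ∀ t ∈ Ioo (-T) T, |f t| ≤ B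
  bound_deriv : ∀ t ∈ Ioo (-T) T, |deriv f t| ≤ B * M
  lip : ∀ s ∈ Ioo (-T) T, ∀ t ∈ Ioo (-T) T, |deriv f s - deriv f t| ≤ B * (σ * M ^ 2) * |s - t|

namespace BddC11

variable {T σ σ' : ℝ} {f g : ℝ → ℝ} {B C M N : ℝ}

theorem mono (hf : BddC11 T σ f B M) (hσ : 0 ≤ σ) (hB : B ≤ C) (hM : M ≤ N) (hσ' : σ ≤ σ') :
    BddC11 T σ' f C N := by
  have h0 := hf.bound_nonneg
  have h1 := hf.nonneg
  have h2 := h0.trans hB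
  exact ⟨h2, h1.trans hM, hf.diff, fun t ht => (hf.bound t ht).trans hB,
    fun t ht => (hf.bound_deriv t ht).trans (by gcongr),
    fun s hs t ht => (hf.lip s hs t ht).trans (by
      have := hσ.trans hσ'
      gcongr)⟩

theorem congr (hf : BddC11 T σ f B M) (h : EqOn g f (Ioo (-T) T)) : BddC11 T σ g B M := by
  have he : ∀ t ∈ Ioo (-T) T, g =ᶠ[nhds t] f := fun t ht =>
    Filter.eventuallyEq_of_mem (Ioo_mem_nhds ht.1 ht.2) h
  refine ⟨hf.bound_nonneg, hf.nonneg, fun t ht => (hf.diff t ht).congr_of_eventuallyEq (he t ht),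
    fun t ht => h ht ▸ hf.bound t ht, fun t ht => (he t ht).deriv_eq ▸ hf.bound_deriv t ht,
    fun s hs t ht => ?_⟩
  rw [(he t ht).deriv_eq, (he s hs).deriv_eq]
  exact hf.lip s hs t ht

theorem abs_sub_le (hf : BddC11 T σ f B M) {s t : ℝ} (hs : s ∈ Ioo (-T) T) (ht : t ∈ Ioo (-T) T) :
    |f s - f t| ≤ B * M * |s - t| :=
  (convex_Ioo (-T) T).norm_image_sub_le_of_norm_deriv_le (fun r hr => hf.diff r hr)
    (fun r hr => hf.bound_deriv r hr) ht hs

theorem continuousOn_deriv (hf : BddC11 T σ f B M) (hσ : 0 ≤ σ) :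
    ContinuousOn (deriv f) (Ioo (-T) T) := by
  have h0 := hf.bound_nonneg
  have h1 := hf.nonneg
  exact (LipschitzOnWith.of_dist_le_mul (K := NNReal.mk (B * (σ * M ^ 2)) (by positivity))
    fun s hs t ht => hf.lip s hs t ht).continuousOn

/-- The relative constants add again. The second-order cross term is `2MN`, and `1 ≤ σ` lets it
complete the square in `σ (M + N)²`. -/
theorem mul (hf : BddC11 T σ f B M) (hg : BddC11 T σ g C N) (hσ : 1 ≤ σ) :
    BddC11 T σ (fun t => f t * g t) (B * C) (M + N) := by
  have hB := hf.bound_nonneg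
  have hM := hf.nonneg
  have hC := hg.bound_nonneg
  have hN := hg.nonneg
  have hd : ∀ t ∈ Ioo (-T) T, deriv (fun t => f t * g t) t = deriv f t * g t + f t * deriv g t :=
    fun t ht => deriv_fun_mul (hf.diff t ht) (hg.diff t ht)
  refine ⟨mul_nonneg hB hC, add_nonneg hM hN, fun t ht => (hf.diff t ht).mul (hg.diff t ht),
    fun t ht => ?_, fun t ht => ?_, fun s hs t ht => ?_⟩
  · rw [abs_mul]
    have := hf.bound t ht
    have := hg.bound t ht
    gcongr
  · rw [hd t ht]
    have h1 := hf.bound t ht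
    have h2 := hg.bound t ht
    have h3 := hf.bound_deriv t ht
    have h4 := hg.bound_deriv t ht
    calc |deriv f t * g t + f t * deriv g t| ≤ |deriv f t| * |g t| + |f t| * |deriv g t| := by
          rw [← abs_mul, ← abs_mul]; exact abs_add_le _ _
      _ ≤ B * M * C + B * (C * N) := by gcongr
      _ = B * C * (M + N) := by ring
  · rw [hd t ht, hd s hs]
    have h1 := hg.bound s hs
    have h2 := hf.bound t ht
    have h3 := hf.bound_deriv t ht
    have h4 := hg.bound_deriv s hs
    have h5 := hf.lip s hs t ht
    have h6 := hg.lip s hs t ht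
    have h7 := hf.abs_sub_le hs ht
    have h8 := hg.abs_sub_le hs ht
    calc |deriv f s * g s + f s * deriv g s - (deriv f t * g t + f t * deriv g t)|
        = |((deriv f s - deriv f t) * g s + deriv f t * (g s - g t)) +
            ((f s - f t) * deriv g s + f t * (deriv g s - deriv g t))| := by ring_nf
      _ ≤ (|deriv f s - deriv f t| * |g s| + |deriv f t| * |g s - g t|) +
            (|f s - f t| * |deriv g s| + |f t| * |deriv g s - deriv g t|) := by
          simp only [← abs_mul]
          exact (abs_add_le _ _).trans (add_le_add (abs_add_le _ _) (abs_add_le _ _))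
      _ ≤ (B * (σ * M ^ 2) * |s - t| * C + B * M * (C * N * |s - t|)) +
            (B * M * |s - t| * (C * N) + B * (C * (σ * N ^ 2) * |s - t|)) := by gcongr
      _ = B * C * (σ * M ^ 2 + 2 * (1 * (M * N)) + σ * N ^ 2) * |s - t| := by ring
      _ ≤ B * C * (σ * M ^ 2 + 2 * (σ * (M * N)) + σ * N ^ 2) * |s - t| := by gcongr
      _ = B * C * (σ * (M + N) ^ 2) * |s - t| := by ring

theorem sub (hf : BddC11 T σ f B M) (hg : BddC11 T σ g C M) :
    BddC11 T σ (fun t => f t - g t) (B + C) M := by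
  have hd : ∀ t ∈ Ioo (-T) T, deriv (fun t => f t - g t) t = deriv f t - deriv g t :=
    fun t ht => deriv_fun_sub (hf.diff t ht) (hg.diff t ht)
  refine ⟨add_nonneg hf.bound_nonneg hg.bound_nonneg, hf.nonneg,
    fun t ht => (hf.diff t ht).sub (hg.diff t ht),
    fun t ht => (abs_sub _ _).trans (add_le_add (hf.bound t ht) (hg.bound t ht)),
    fun t ht => ?_, fun s hs t ht => ?_⟩
  · rw [hd t ht, add_mul]
    exact (abs_sub _ _).trans (add_le_add (hf.bound_deriv t ht) (hg.bound_deriv t ht))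
  · rw [hd t ht, hd s hs]
    calc |deriv f s - deriv g s - (deriv f t - deriv g t)|
        = |(deriv f s - deriv f t) - (deriv g s - deriv g t)| := by ring_nf
      _ ≤ |deriv f s - deriv f t| + |deriv g s - deriv g t| := abs_sub _ _
      _ ≤ B * (σ * M ^ 2) * |s - t| + C * (σ * M ^ 2) * |s - t| :=
          add_le_add (hf.lip s hs t ht) (hg.lip s hs t ht)
      _ = (B + C) * (σ * M ^ 2) * |s - t| := by ring

theorem neg (hf : BddC11 T σ f B M) : BddC11 T σ (fun t => -f t) B M := by
  have hd : ∀ t, deriv (fun t => -f t) t = -deriv f t := fun t => deriv.fun_neg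
  refine ⟨hf.bound_nonneg, hf.nonneg, fun t ht => (hf.diff t ht).neg,
    fun t ht => by rw [abs_neg]; exact hf.bound t ht,
    fun t ht => by rw [hd, abs_neg]; exact hf.bound_deriv t ht, fun s hs t ht => ?_⟩
  rw [hd, hd, ← abs_neg]
  simpa [sub_eq_add_neg, add_comm] using hf.lip s hs t ht

theorem const_sub (hf : BddC11 T σ f B M) (k : ℝ) (hk : ∀ t ∈ Ioo (-T) T, |k - f t| ≤ B) :
    BddC11 T σ (fun t => k - f t) B M := by
  have hd : ∀ t, deriv (fun t => k - f t) t = -deriv f t := fun t => by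
    rw [deriv_const_sub]
  refine ⟨hf.bound_nonneg, hf.nonneg, fun t ht => (hf.diff t ht).const_sub k, hk,
    fun t ht => by rw [hd, abs_neg]; exact hf.bound_deriv t ht, fun s hs t ht => ?_⟩
  rw [hd, hd, ← abs_neg]
  simpa [sub_eq_add_neg, add_comm] using hf.lip s hs t ht

/-- With `ρ = B/m ≥ 1`, the second-order estimate produces `3 ρ² M²`. The factor `2` in the new
constant `2ρM` leaves room for it, as `3 ≤ 2²`. -/
theorem inv (hf : BddC11 T σ f B M) (hσ : 1 ≤ σ) {m : ℝ} (hm : 0 < m)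
    (h : ∀ t ∈ Ioo (-T) T, m ≤ f t) (hmB : m ≤ B) :
    BddC11 T σ (fun t => (f t)⁻¹) m⁻¹ (2 * (B * m⁻¹) * M) := by
  have hB := hf.bound_nonneg
  have hM := hf.nonneg
  have hpos : ∀ t ∈ Ioo (-T) T, 0 < f t := fun t ht => hm.trans_le (h t ht)
  have hd : ∀ t ∈ Ioo (-T) T, deriv (fun t => (f t)⁻¹) t = -(deriv f t * ((f t)⁻¹ * (f t)⁻¹)) :=
    fun t ht => by
      rw [((hf.diff t ht).hasDerivAt.fun_inv (hpos t ht).ne').deriv]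
      field_simp
  have hi : ∀ t ∈ Ioo (-T) T, (f t)⁻¹ ≤ m⁻¹ := fun t ht => inv_anti₀ hm (h t ht)
  have hi0 : ∀ t ∈ Ioo (-T) T, 0 < (f t)⁻¹ := fun t ht => inv_pos.2 (hpos t ht)
  have hρ : 1 ≤ B * m⁻¹ := by rw [← div_eq_mul_inv, le_div_iff₀ hm]; linarith
  refine ⟨by positivity, by positivity, fun t ht => (hf.diff t ht).inv (hpos t ht).ne',
    fun t ht => ?_, fun t ht => ?_, fun s hs t ht => ?_⟩
  · rw [abs_of_pos (hi0 t ht)]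
    exact hi t ht
  · have h1 := hi t ht
    have h2 := hi0 t ht
    have h3 := hf.bound_deriv t ht
    rw [hd t ht, abs_neg, abs_mul, abs_of_pos (mul_pos h2 h2)]
    calc |deriv f t| * ((f t)⁻¹ * (f t)⁻¹) ≤ B * M * (m⁻¹ * m⁻¹) := by gcongr
      _ = m⁻¹ * (1 * (B * m⁻¹) * M) := by ring
      _ ≤ m⁻¹ * (2 * (B * m⁻¹) * M) := by gcongr; norm_num
  · have hs1 := hi s hs
    have hs2 := hi0 s hs
    have ht1 := hi t ht
    have ht2 := hi0 t ht
    have h3 := hf.bound_deriv t ht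
    have h5 := hf.lip s hs t ht
    have h7 := hf.abs_sub_le hs ht
    have hsub : |(f s)⁻¹ - (f t)⁻¹| ≤ B * M * |s - t| * (m⁻¹ * m⁻¹) := by
      have : (f s)⁻¹ - (f t)⁻¹ = -(f s - f t) * ((f s)⁻¹ * (f t)⁻¹) := by
        have := hpos s hs
        have := hpos t ht
        field_simp
        ring
      rw [this, abs_mul, abs_neg, abs_of_pos (mul_pos hs2 ht2)]
      gcongr
    rw [hd t ht, hd s hs]
    calc |-(deriv f s * ((f s)⁻¹ * (f s)⁻¹)) - -(deriv f t * ((f t)⁻¹ * (f t)⁻¹))|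
        = |-((deriv f s - deriv f t) * ((f s)⁻¹ * (f s)⁻¹)) -
            deriv f t * (((f s)⁻¹ - (f t)⁻¹) * ((f s)⁻¹ + (f t)⁻¹))| := by ring_nf
      _ ≤ |deriv f s - deriv f t| * ((f s)⁻¹ * (f s)⁻¹) +
            |deriv f t| * (|(f s)⁻¹ - (f t)⁻¹| * ((f s)⁻¹ + (f t)⁻¹)) := by
          refine (abs_sub _ _).trans (le_of_eq ?_)
          rw [abs_neg, abs_mul, abs_mul, abs_mul, abs_mul, abs_of_pos hs2,
            abs_of_pos (add_pos hs2 ht2)]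
      _ ≤ B * (σ * M ^ 2) * |s - t| * (m⁻¹ * m⁻¹) +
            B * M * (B * M * |s - t| * (m⁻¹ * m⁻¹) * (m⁻¹ + m⁻¹)) := by gcongr
      _ = m⁻¹ * (M ^ 2 * (σ * (1 * (B * m⁻¹)) + 1 * (2 * (B * m⁻¹) ^ 2))) * |s - t| := by ring
      _ ≤ m⁻¹ * (M ^ 2 * (σ * ((B * m⁻¹) * (B * m⁻¹)) + σ * (2 * (B * m⁻¹) ^ 2))) * |s - t| := by
          gcongr
      _ = m⁻¹ * (σ * (3 * (B * m⁻¹) ^ 2 * M ^ 2)) * |s - t| := by ring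
      _ ≤ m⁻¹ * (σ * (4 * (B * m⁻¹) ^ 2 * M ^ 2)) * |s - t| := by gcongr; norm_num
      _ = m⁻¹ * (σ * (2 * (B * m⁻¹) * M) ^ 2) * |s - t| := by ring

theorem average {n : ℕ} (hn : 0 < n) {f : Fin n → ℝ → ℝ} (hf : ∀ i, BddC11 T σ (f i) B M) :
    BddC11 T σ (fun t => (1 / (n : ℝ)) * ∑ i, f i t) B M := by
  have hn' : (0 : ℝ) < n := by exact_mod_cast hn
  have hd : ∀ t ∈ Ioo (-T) T, HasDerivAt (fun t => (1 / (n : ℝ)) * ∑ i, f i t)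
      ((1 / (n : ℝ)) * ∑ i, deriv (f i) t) t := fun t ht =>
    (HasDerivAt.fun_sum fun i _ => ((hf i).diff t ht).hasDerivAt).const_mul _
  have key : ∀ (a : Fin n → ℝ) (A : ℝ), (∀ i, |a i| ≤ A) → |(1 / (n : ℝ)) * ∑ i, a i| ≤ A := by
    intro a A ha
    rw [abs_mul, abs_of_pos (by positivity : (0 : ℝ) < 1 / n)]
    calc 1 / (n : ℝ) * |∑ i, a i| ≤ 1 / (n : ℝ) * ∑ _i : Fin n, A := by
          gcongr
          exact (Finset.abs_sum_le_sum_abs _ _).trans (Finset.sum_le_sum fun i _ => ha i)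
      _ = A := by simp; field_simp
  refine ⟨(hf ⟨0, hn⟩).bound_nonneg, (hf ⟨0, hn⟩).nonneg, fun t ht => (hd t ht).differentiableAt,
    fun t ht => key _ _ fun i => (hf i).bound t ht, fun t ht => ?_, fun s hs t ht => ?_⟩
  · rw [(hd t ht).deriv]
    exact key _ _ fun i => (hf i).bound_deriv t ht
  · rw [(hd t ht).deriv, (hd s hs).deriv, ← mul_sub, ← Finset.sum_sub_distrib]
    exact key _ _ fun i => (hf i).lip s hs t ht

/-- In `l'(f) f'`, the variation of `l'(f)` contributes one further `M²`, which raises `σ` by `1`.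
-/
theorem comp {l l1 : ℝ → ℝ} {S : Set ℝ} {z : ℝ} (hf : BddC11 T σ f 1 M) (hσ : σ + 1 ≤ σ')
    (hS : ∀ t ∈ Ioo (-T) T, f t ∈ S) (hl : ∀ u ∈ S, HasDerivAt l (l1 u) u)
    (hz : ∀ u ∈ S, |l u| ≤ z) (hz1 : ∀ u ∈ S, |l1 u| ≤ z) (hz0 : 0 ≤ z)
    (hlip : ∀ u ∈ S, ∀ v ∈ S, |l1 u - l1 v| ≤ z * |u - v|) :
    BddC11 T σ' (fun t => l (f t)) z M := by
  have hM := hf.nonneg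
  have hd : ∀ t ∈ Ioo (-T) T, HasDerivAt (fun t => l (f t)) (l1 (f t) * deriv f t) t :=
    fun t ht => (hl _ (hS t ht)).comp t (hf.diff t ht).hasDerivAt
  refine ⟨hz0, hM, fun t ht => (hd t ht).differentiableAt, fun t ht => hz _ (hS t ht),
    fun t ht => ?_, fun s hs t ht => ?_⟩
  · have h1 := hz1 _ (hS t ht)
    have h2 := hf.bound_deriv t ht
    rw [one_mul] at h2
    rw [(hd t ht).deriv, abs_mul]
    gcongr
  · have h1 := hlip _ (hS s hs) _ (hS t ht)
    have h2 := hf.bound_deriv s hs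
    have h3 := hz1 _ (hS t ht)
    have h4 := hf.lip s hs t ht
    have h5 := hf.abs_sub_le hs ht
    rw [one_mul] at h2 h4 h5
    rw [(hd t ht).deriv, (hd s hs).deriv]
    calc |l1 (f s) * deriv f s - l1 (f t) * deriv f t|
        = |(l1 (f s) - l1 (f t)) * deriv f s + l1 (f t) * (deriv f s - deriv f t)| := by ring_nf
      _ ≤ |l1 (f s) - l1 (f t)| * |deriv f s| + |l1 (f t)| * |deriv f s - deriv f t| := by
          rw [← abs_mul, ← abs_mul]; exact abs_add_le _ _
      _ ≤ z * (M * |s - t|) * M + z * (σ * M ^ 2 * |s - t|) := by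
          have := h1.trans (mul_le_mul_of_nonneg_left h5 hz0)
          gcongr
      _ = z * ((σ + 1) * M ^ 2) * |s - t| := by ring
      _ ≤ z * (σ' * M ^ 2) * |s - t| := by gcongr

end BddC11

/-! ### Regularity of the path and of the score along it. -/

section Trajectory

variable {K : Type*} [TopologicalSpace K] [CompactSpace K]

theorem hasDerivAt_fst_apply {U : ℝ → Triple K} {U' : Triple K} {t : ℝ} (h : HasDerivAt U U' t)
    (k : K) : HasDerivAt (fun s => (U s).1 k) (U'.1 k) t :=
  ((ContinuousMap.evalCLM ℝ k).comp
    (ContinuousLinearMap.fst ℝ C(K, ℝ) (C(K, ℝ) × C(K, ℝ)))).hasFDerivAt.comp_hasDerivAt t h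

theorem hasDerivAt_snd_fst_apply {U : ℝ → Triple K} {U' : Triple K} {t : ℝ}
    (h : HasDerivAt U U' t) (k : K) : HasDerivAt (fun s => (U s).2.1 k) (U'.2.1 k) t :=
  ((ContinuousMap.evalCLM ℝ k).comp ((ContinuousLinearMap.fst ℝ C(K, ℝ) C(K, ℝ)).comp
    (ContinuousLinearMap.snd ℝ C(K, ℝ) (C(K, ℝ) × C(K, ℝ))))).hasFDerivAt.comp_hasDerivAt t h

theorem hasDerivAt_snd_snd_apply {U : ℝ → Triple K} {U' : Triple K} {t : ℝ}
    (h : HasDerivAt U U' t) (k : K) : HasDerivAt (fun s => (U s).2.2 k) (U'.2.2 k) t :=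
  ((ContinuousMap.evalCLM ℝ k).comp ((ContinuousLinearMap.snd ℝ C(K, ℝ) C(K, ℝ)).comp
    (ContinuousLinearMap.snd ℝ C(K, ℝ) (C(K, ℝ) × C(K, ℝ))))).hasFDerivAt.comp_hasDerivAt t h

/-- A real function along a bounded Lipschitz differential equation whose derivative is a bounded
Lipschitz function of the state. -/
theorem bddC11_of_hasDerivAt {E : Type*} [PseudoMetricSpace E] {T z : ℝ} {U : ℝ → E} {f : ℝ → ℝ}
    {v : E → ℝ} (hv : BddLip v (3 * z ^ 4) (3 * z ^ 2))
    (hU : ∀ s ∈ Ioo (-T) T, ∀ t ∈ Ioo (-T) T, dist (U s) (U t) ≤ 3 * z ^ 4 * |s - t|)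
    (hf : ∀ t ∈ Ioo (-T) T, HasDerivAt f (v (U t)) t) (hb : ∀ t ∈ Ioo (-T) T, |f t| ≤ 1) :
    BddC11 T (3 * z ^ 2) f 1 (3 * z ^ 4) := by
  refine ⟨zero_le_one, by positivity, fun t ht => (hf t ht).differentiableAt, hb,
    fun t ht => ?_, fun s hs t ht => ?_⟩
  · rw [(hf t ht).deriv, one_mul]
    exact hv.bound _
  · rw [(hf t ht).deriv, (hf s hs).deriv]
    calc |v (U s) - v (U t)| ≤ 3 * z ^ 4 * (3 * z ^ 2) * dist (U s) (U t) := hv.lip _ _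
      _ ≤ 3 * z ^ 4 * (3 * z ^ 2) * (3 * z ^ 4 * |s - t|) := by gcongr; exact hU s hs t ht
      -- Here `M = 3z⁴` is the speed of the trajectory and `σ = 3z²` is the relative Lipschitz
      -- constant of the field.
      _ = 1 * (3 * z ^ 2 * (3 * z ^ 4) ^ 2) * |s - t| := by ring

end Trajectory

section Path

variable {d n : ℕ} {lam : ℝ → ℝ} {c : ℝ} {U0 : Nuis d} {x : Fin n → Cov d} {U : ℝ → Nuis d}

/-- The conclusions about a solution path at a fixed covariate value. -/
structure PathAt (lam : ℝ → ℝ) (c η : ℝ) (x : Fin n → Cov d) (U : ℝ → Nuis d) : Prop where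
  pos : 0 < c
  lt : c < 1 / 4
  regular : ∀ t ∈ Ioo (-t1 c) (t1 c), RegularAt lam c η (U t)
  q1_deriv : ∀ t ∈ Ioo (-t1 c) (t1 c), ∀ y,
    HasDerivAt (fun s => (U s).1 y) (F1 lam (empirical x) (U t) y) t
  q0_deriv : ∀ t ∈ Ioo (-t1 c) (t1 c), ∀ y,
    HasDerivAt (fun s => (U s).2.1 y) (F0 lam (empirical x) (U t) y) t
  ps_deriv : ∀ t ∈ Ioo (-t1 c) (t1 c), ∀ y,
    HasDerivAt (fun s => (U s).2.2 y) (Fe lam (empirical x) (U t) y) t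
  q1_bdd : ∀ y, BddC11 (t1 c) (3 * c⁻¹ ^ 2) (fun s => (U s).1 y) 1 (3 * c⁻¹ ^ 4)
  q0_bdd : ∀ y, BddC11 (t1 c) (3 * c⁻¹ ^ 2) (fun s => (U s).2.1 y) 1 (3 * c⁻¹ ^ 4)
  ps_bdd : ∀ y, BddC11 (t1 c) (3 * c⁻¹ ^ 2) (fun s => (U s).2.2 y) 1 (3 * c⁻¹ ^ 4)

theorem IsPath.exists_pathAt (hn : 0 < n) (h : IsPath lam (empirical x) U0 c U) :
    ∃ η, RegularWeight lam c η ∧ PathAt lam c η x U := by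
  obtain ⟨η, hp, hr, hR⟩ := h.exists_regularAt
  have hw := hp.regularWeight hr
  have hc := hw.pos
  have hc4 := hw.lt_quarter
  obtain ⟨g0, g1, hg⟩ := exists_isWeightExtension (lam := lam) hc (by linarith)
  have hU := h.hasDerivAt hg hc hc4
  have hdist : ∀ s ∈ Ioo (-t1 c) (t1 c), ∀ t ∈ Ioo (-t1 c) (t1 c),
      dist (U s) (U t) ≤ 3 * c⁻¹ ^ 4 * |s - t| := fun s hs t ht => by
    rw [dist_eq_norm]
    exact norm_solution_sub_le (norm_truncField_le (x := x) hg hc hc4 hn) hU ht hs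
  have h01 : ∀ {u : ℝ}, u ∈ Icc (0 : ℝ) 1 → |u| ≤ 1 := fun hu =>
    abs_le.2 ⟨by linarith [hu.1], hu.2⟩
  have h1 := fun t ht y => hasDerivAt_fst_apply (hU t ht) y
  have h0 := fun t ht y => hasDerivAt_snd_fst_apply (hU t ht) y
  have he := fun t ht y => hasDerivAt_snd_snd_apply (hU t ht) y
  refine ⟨η, hw, hc, hc4, hR, fun t ht y => ?_, fun t ht y => ?_, fun t ht y => ?_,
    fun y => ?_, fun y => ?_, fun y => ?_⟩
  · exact (hR t ht).field1_eq (x := x) hg y ▸ h1 t ht y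
  · exact (hR t ht).field0_eq (x := x) hg y ▸ h0 t ht y
  · exact (hR t ht).fielde_eq (x := x) hg y ▸ he t ht y
  · exact bddC11_of_hasDerivAt (hg.bddLip_field1 hc hc4 hn y) hdist (fun t ht => h1 t ht y)
      fun t ht => h01 ((hR t ht).q1_mem y)
  · exact bddC11_of_hasDerivAt (hg.bddLip_field0 hc hc4 hn y) hdist (fun t ht => h0 t ht y)
      fun t ht => h01 ((hR t ht).q0_mem y)
  · refine bddC11_of_hasDerivAt (hg.bddLip_fielde hc hc4 hn y) hdist (fun t ht => he t ht y)
      fun t ht => ?_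
    have := hw.mem.1
    exact h01 ⟨by linarith [((hR t ht).ps_mem y).1], by linarith [((hR t ht).ps_mem y).2]⟩

namespace RegularAt

variable {η : ℝ} {V : Nuis d}

theorem values_Ioo (h : RegularAt lam c η V) (y : Cov d) :
    V.1 y ∈ Ioo (0 : ℝ) 1 ∧ V.2.1 y ∈ Ioo (0 : ℝ) 1 ∧ V.2.2 y ∈ Ioo c (1 - c) := by
  obtain ⟨h1, h2, h3⟩ := h.values y
  have h0 := h.regular.mem.1
  have hc := h.regular.le_margin
  have := h.regular.pos
  simp only [q1, q0, ps, mem_Icc] at h1 h2 h3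
  exact ⟨⟨by linarith, by linarith⟩, ⟨by linarith, by linarith⟩, ⟨by linarith, by linarith⟩⟩

theorem le_Omega (h : RegularAt lam c η V) (hn : 0 < n) : c ≤ Omega lam (empirical x) V := by
  have hn' : (0 : ℝ) < n := by exact_mod_cast hn
  rw [Omega_empirical]
  calc c = 1 / (n : ℝ) * ∑ _j : Fin n, c := by simp; field_simp
    _ ≤ _ := by
      gcongr
      exact h.regular.le_weight (Ioo_subset_Icc_self (h.ps_mem _))

theorem pU_pos (h : RegularAt lam c η V) (a y : Fin 2) (k : Cov d) : 0 < pU V a y k := by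
  obtain ⟨h1, h0, he⟩ := h.values_Ioo k
  have hc := h.regular.pos
  have e1 : 0 < ps V k := hc.trans he.1
  have e2 : 0 < 1 - ps V k := by have := he.2; simp only [ps]; linarith
  have e3 : 0 < q1 V k := h1.1
  have e4 : 0 < 1 - q1 V k := sub_pos.2 h1.2
  have e5 : 0 < q0 V k := h0.1
  have e6 : 0 < 1 - q0 V k := sub_pos.2 h0.2
  unfold pU
  fin_cases a <;> simp [qa] <;> positivity

end RegularAt

namespace PathAt

variable {η : ℝ}

/-- Along the path, the logarithmic derivative of `p_{U_t}` is `D*`. -/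
theorem hasDerivAt_pU (h : PathAt lam c η x U) (hn : 0 < n) {t : ℝ}
    (ht : t ∈ Ioo (-t1 c) (t1 c)) (a y : Fin 2) (k : Cov d) :
    HasDerivAt (fun s => pU (U s) a y k)
      (pU (U t) a y k * Dstar lam (empirical x) (U t) (k, (a, y))) t := by
  have hR := h.regular t ht
  obtain ⟨h1, h0, he⟩ := hR.values_Ioo k
  have hc := h.pos
  have hΩ : Omega lam (empirical x) (U t) ≠ 0 := (hc.trans_le (hR.le_Omega hn)).ne'
  have d1 := h.q1_deriv t ht k
  have d0 := h.q0_deriv t ht k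
  have de := h.ps_deriv t ht k
  have e1 : (U t).2.2 k ≠ 0 := (hc.trans he.1).ne'
  have e2 : 1 - (U t).2.2 k ≠ 0 := by have := he.2; exact ne_of_gt (by linarith)
  have hτ : tau (U t) k = (U t).1 k - (U t).2.1 k := rfl
  -- Each likelihood is a product of two Bernoulli factors. Dividing a component of `F` by its
  -- Bernoulli variance gives the matching coefficient in `D*`.
  fin_cases a <;> fin_cases y
  · have := (de.const_sub 1).mul (d0.const_sub 1)
    convert! this using 1
    · funext s; simp [pU, qa, ps, q0]
    · simp [pU, qa, Dstar, phi, F0, Fe, ps, q0, q1]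
      field_simp
      ring
  · have := (de.const_sub 1).mul d0
    convert! this using 1
    · funext s; simp [pU, qa, ps, q0]
    · simp [pU, qa, Dstar, phi, F0, Fe, ps, q0, q1]
      field_simp
      ring
  · have := de.mul (d1.const_sub 1)
    convert! this using 1
    · funext s; simp [pU, qa, ps, q1]
    · simp [pU, qa, Dstar, phi, F1, Fe, ps, q0, q1]
      field_simp
      ring
  · have := de.mul d1
    convert! this using 1
    · funext s; simp [pU, qa, ps, q1]
    · simp [pU, qa, Dstar, phi, F1, Fe, ps, q0, q1]
      field_simp
      ring

theorem hasDerivAt_log_pU (h : PathAt lam c η x U) (hn : 0 < n) {t : ℝ}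
    (ht : t ∈ Ioo (-t1 c) (t1 c)) (a y : Fin 2) (k : Cov d) :
    HasDerivAt (fun s => Real.log (pU (U s) a y k))
      (Dstar lam (empirical x) (U t) (k, (a, y))) t := by
  have hp := (h.regular t ht).pU_pos a y k
  have := (h.hasDerivAt_pU hn ht a y k).log hp.ne'
  rwa [mul_div_cancel_left₀ _ hp.ne'] at this

end PathAt

end Path

namespace PathAt

variable {d n : ℕ} {lam : ℝ → ℝ} {c η : ℝ} {x : Fin n → Cov d} {U : ℝ → Nuis d}

theorem four_le_inv (h : PathAt lam c η x U) : 4 ≤ c⁻¹ := by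
  rw [le_inv_comm₀ (by norm_num) h.pos]
  linarith [h.lt]

theorem bddC11_q1 (h : PathAt lam c η x U) (y : Cov d) :
    BddC11 (t1 c) (4 * c⁻¹ ^ 2) (fun s => (U s).1 y) 1 (3 * c⁻¹ ^ 4) :=
  (h.q1_bdd y).mono (by positivity) le_rfl le_rfl (by gcongr; norm_num)

theorem bddC11_q0 (h : PathAt lam c η x U) (y : Cov d) :
    BddC11 (t1 c) (4 * c⁻¹ ^ 2) (fun s => (U s).2.1 y) 1 (3 * c⁻¹ ^ 4) :=
  (h.q0_bdd y).mono (by positivity) le_rfl le_rfl (by gcongr; norm_num)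

theorem bddC11_ps (h : PathAt lam c η x U) (y : Cov d) :
    BddC11 (t1 c) (4 * c⁻¹ ^ 2) (fun s => (U s).2.2 y) 1 (3 * c⁻¹ ^ 4) :=
  (h.ps_bdd y).mono (by positivity) le_rfl le_rfl (by gcongr; norm_num)

/-- The components of the path have `σ = 3c⁻²` and composition with `lam` or its derivative adds
`1`. The value `4c⁻²` therefore serves all factors of the score. -/
theorem sigma_le (h : PathAt lam c η x U) : 3 * c⁻¹ ^ 2 + 1 ≤ 4 * c⁻¹ ^ 2 := by
  nlinarith [h.four_le_inv]

theorem one_le_sigma (h : PathAt lam c η x U) : 1 ≤ 4 * c⁻¹ ^ 2 := by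
  nlinarith [h.four_le_inv]

theorem bddC11_weight (h : PathAt lam c η x U) (hw : RegularWeight lam c η) (y : Cov d) :
    BddC11 (t1 c) (4 * c⁻¹ ^ 2) (fun s => lam ((U s).2.2 y)) c⁻¹ (3 * c⁻¹ ^ 4) := by
  have hc := h.pos
  refine (h.ps_bdd y).comp (S := Ioo η (1 - η)) h.sigma_le (fun t ht => (h.regular t ht).ps_mem y)
    (fun u hu => hw.deriv_weight hu ▸ hw.hasDerivAt_weight hu) (fun u hu => ?_)
    (fun u hu => hw.abs_deriv_weight_le hu) (by positivity)
    fun u hu v hv => hw.abs_deriv_weight_sub_le hu hv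
  rw [abs_of_nonneg (hc.le.trans (hw.le_weight (Ioo_subset_Icc_self hu)))]
  exact hw.weight_le (Ioo_subset_Icc_self hu)

/-- This is where the third derivative of `lam` enters: it makes the second derivative Lipschitz. -/
theorem bddC11_deriv_weight (h : PathAt lam c η x U) (hw : RegularWeight lam c η) (y : Cov d) :
    BddC11 (t1 c) (4 * c⁻¹ ^ 2) (fun s => deriv lam ((U s).2.2 y)) c⁻¹ (3 * c⁻¹ ^ 4) := by
  have hc := h.pos
  obtain ⟨l2, hl2⟩ := hw.exists_second_deriv
  exact (h.ps_bdd y).comp (S := Ioo η (1 - η)) h.sigma_le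
    (fun t ht => (h.regular t ht).ps_mem y) (fun u hu => (hl2 u hu).1)
    (fun u hu => hw.abs_deriv_weight_le hu) (fun u hu => (hl2 u hu).2.1) (by positivity)
    fun u hu v hv => (hl2 u hu).2.2 v hv

theorem bddC11_inv_Omega (h : PathAt lam c η x U) (hw : RegularWeight lam c η) (hn : 0 < n) :
    BddC11 (t1 c) (4 * c⁻¹ ^ 2) (fun s => (Omega lam (empirical x) (U s))⁻¹) c⁻¹
      (2 * c⁻¹ ^ 2 * (3 * c⁻¹ ^ 4)) := by
  have hz := h.four_le_inv
  have h1 : BddC11 (t1 c) (4 * c⁻¹ ^ 2) (fun s => Omega lam (empirical x) (U s)) c⁻¹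
      (3 * c⁻¹ ^ 4) :=
    (BddC11.average hn fun j => h.bddC11_weight hw (x j)).congr fun t _ => Omega_empirical x lam _
  have := h1.inv h.one_le_sigma h.pos (fun t ht => (h.regular t ht).le_Omega hn)
    (by linarith [h.lt])
  rwa [← sq] at this

theorem bddC11_tau (h : PathAt lam c η x U) (y : Cov d) :
    BddC11 (t1 c) (4 * c⁻¹ ^ 2) (fun s => tau (U s) y) 2 (3 * c⁻¹ ^ 4) := by
  rw [show (2 : ℝ) = 1 + 1 by norm_num]
  convert! (h.bddC11_q1 y).sub (h.bddC11_q0 y) using 1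

theorem bddC11_psi (h : PathAt lam c η x U) (hw : RegularWeight lam c η) (hn : 0 < n) :
    BddC11 (t1 c) (4 * c⁻¹ ^ 2) (fun s => psi lam (empirical x) (U s)) (2 * c⁻¹ ^ 2)
      ((2 + 2 * c⁻¹ ^ 2) * (3 * c⁻¹ ^ 4)) := by
  have := (BddC11.average hn fun j => (h.bddC11_weight hw (x j)).mul (h.bddC11_tau (x j))
    h.one_le_sigma).mul (h.bddC11_inv_Omega hw hn) h.one_le_sigma
  refine (this.congr fun t _ => ?_).mono (by positivity) (le_of_eq (by ring)) (le_of_eq (by ring))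
    le_rfl
  rw [psi_empirical, ← Omega_empirical]
  rfl

theorem bddC11_inv_ps (h : PathAt lam c η x U) (y : Cov d) :
    BddC11 (t1 c) (4 * c⁻¹ ^ 2) (fun s => ((U s).2.2 y)⁻¹) c⁻¹
      (2 * c⁻¹ * (3 * c⁻¹ ^ 4)) := by
  have := (h.bddC11_ps y).inv h.one_le_sigma h.pos
    (fun t ht => ((h.regular t ht).values_Ioo y).2.2.1.le) (by linarith [h.lt])
  rwa [one_mul] at this

theorem bddC11_one_sub_ps (h : PathAt lam c η x U) (y : Cov d) :
    BddC11 (t1 c) (4 * c⁻¹ ^ 2) (fun s => 1 - (U s).2.2 y) 1 (3 * c⁻¹ ^ 4) :=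
  (h.bddC11_ps y).const_sub 1 fun t ht => by
    have := ((h.regular t ht).values_Ioo y).2.2
    have hc := h.pos
    exact abs_le.2 ⟨by linarith [this.1, this.2], by linarith [this.1, this.2]⟩

theorem bddC11_inv_one_sub_ps (h : PathAt lam c η x U) (y : Cov d) :
    BddC11 (t1 c) (4 * c⁻¹ ^ 2) (fun s => (1 - (U s).2.2 y)⁻¹) c⁻¹
      (2 * c⁻¹ * (3 * c⁻¹ ^ 4)) := by
  have := (h.bddC11_one_sub_ps y).inv h.one_le_sigma h.pos
    (fun t ht => by linarith [((h.regular t ht).values_Ioo y).2.2.2]) (by linarith [h.lt])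
  rwa [one_mul] at this

/-- All four label values give `D*` this shape: `r` is `a - e`, `i` an inverse propensity and `q` a
signed outcome residual. With `z = c⁻¹`, both relative constants are at most `5z² * 3z⁴ = 15z⁶`, and
the bounds sum to `2z⁴ + 2z² + z³ ≤ 3z⁴`. -/
theorem bddC11_score (h : PathAt lam c η x U) (hw : RegularWeight lam c η) (hn : 0 < n)
    {i q r : ℝ → ℝ} (hi : BddC11 (t1 c) (4 * c⁻¹ ^ 2) i c⁻¹ (2 * c⁻¹ * (3 * c⁻¹ ^ 4)))
    (hq : BddC11 (t1 c) (4 * c⁻¹ ^ 2) q 1 (3 * c⁻¹ ^ 4))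
    (hr : BddC11 (t1 c) (4 * c⁻¹ ^ 2) r 1 (3 * c⁻¹ ^ 4)) (y : Cov d) :
    BddC11 (t1 c) (4 * c⁻¹ ^ 2) (fun s =>
      deriv lam ((U s).2.2 y) * (Omega lam (empirical x) (U s))⁻¹ *
        (tau (U s) y - psi lam (empirical x) (U s)) * r s
      - -(lam ((U s).2.2 y) * (Omega lam (empirical x) (U s))⁻¹ * i s * q s))
      (3 * c⁻¹ ^ 4) (15 * c⁻¹ ^ 6) := by
  have hz := h.four_le_inv
  have hσ := h.one_le_sigma
  have hσ0 : (0 : ℝ) ≤ 4 * c⁻¹ ^ 2 := by positivity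
  have h1 := ((((h.bddC11_deriv_weight hw y).mul (h.bddC11_inv_Omega hw hn) hσ).mul
    (((h.bddC11_tau y).mono hσ0 le_rfl (le_mul_of_one_le_left (by positivity)
      (by nlinarith)) le_rfl).sub (h.bddC11_psi hw hn)) hσ).mul hr hσ)
  have h2 := ((((h.bddC11_weight hw y).mul (h.bddC11_inv_Omega hw hn) hσ).mul hi hσ).mul hq hσ).neg
  have key : ∀ z : ℝ, 4 ≤ z → 4 + 4 * z ^ 2 ≤ 5 * z ^ 2 := fun z hz => by nlinarith
  have key2 : ∀ z : ℝ, 4 ≤ z → 2 + 2 * z ^ 2 + 2 * z ≤ 5 * z ^ 2 := fun z hz => by nlinarith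
  refine ((h1.mono hσ0 le_rfl (N := 15 * c⁻¹ ^ 6) ?_ le_rfl).sub
    (h2.mono hσ0 le_rfl (N := 15 * c⁻¹ ^ 6) ?_ le_rfl)).mono hσ0 ?_ le_rfl le_rfl
  · have := mul_le_mul_of_nonneg_right (key _ hz) (show 0 ≤ 3 * c⁻¹ ^ 4 by positivity)
    linarith
  · have := mul_le_mul_of_nonneg_right (key2 _ hz) (show 0 ≤ 3 * c⁻¹ ^ 4 by positivity)
    linarith
  · generalize c⁻¹ = z at *
    nlinarith [mul_nonneg (sq_nonneg z) (show 0 ≤ z ^ 2 - z - 2 by nlinarith)]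

/-- Along the path, `D*` is bounded with bounded and Lipschitz time derivative. -/
theorem bddC11_Dstar (h : PathAt lam c η x U) (hw : RegularWeight lam c η) (hn : 0 < n)
    (y : Cov d) (b : Fin 2 × Fin 2) :
    BddC11 (t1 c) (4 * c⁻¹ ^ 2) (fun s => Dstar lam (empirical x) (U s) (y, b))
      (3 * c⁻¹ ^ 4) (15 * c⁻¹ ^ 6) := by
  obtain ⟨a, y'⟩ := b
  have hq1 := h.bddC11_q1 y
  have hq0 := h.bddC11_q0 y
  have hq1' : BddC11 (t1 c) (4 * c⁻¹ ^ 2) (fun s => 1 - (U s).1 y) 1 (3 * c⁻¹ ^ 4) :=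
    hq1.const_sub 1 fun t ht => by
      have := (h.regular t ht).q1_mem y
      exact abs_le.2 ⟨by linarith [this.2], by linarith [this.1]⟩
  have hq0' : BddC11 (t1 c) (4 * c⁻¹ ^ 2) (fun s => 1 - (U s).2.1 y) 1 (3 * c⁻¹ ^ 4) :=
    hq0.const_sub 1 fun t ht => by
      have := (h.regular t ht).q0_mem y
      exact abs_le.2 ⟨by linarith [this.2], by linarith [this.1]⟩
  have he := h.bddC11_ps y
  have he' := h.bddC11_one_sub_ps y
  have hie := h.bddC11_inv_ps y
  have hie' := h.bddC11_inv_one_sub_ps y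
  fin_cases a <;> fin_cases y'
  · convert! h.bddC11_score hw hn hie' hq0 he.neg y using 2
    simp [Dstar, phi, ps, q0, q1]
    ring
  · convert! h.bddC11_score hw hn hie' hq0'.neg he.neg y using 2
    simp [Dstar, phi, ps, q0, q1]
    ring
  · convert! h.bddC11_score hw hn hie hq1.neg he' y using 2
    simp [Dstar, phi, ps, q0, q1]
    ring
  · convert! h.bddC11_score hw hn hie hq1' he' y using 2
    simp [Dstar, phi, ps, q0, q1]
    ring

end PathAt

/-! ### A zero criterion and Hoeffding's inequality. -/

/-- A strictly decreasing function that is small at the centre of an interval has exactly one zero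
there. -/
theorem existsUnique_zero_of_deriv_le {f : ℝ → ℝ} {δ κ : ℝ} (hκ : 0 < κ) (hδ : 0 < δ)
    (hf : ∀ t ∈ Icc (-δ) δ, DifferentiableAt ℝ f t) (hd : ∀ t ∈ Icc (-δ) δ, deriv f t ≤ -κ)
    (h0 : |f 0| < κ * δ) : ∃! t, t ∈ Icc (-δ) δ ∧ f t = 0 := by
  have hcont : ContinuousOn f (Icc (-δ) δ) := fun t ht => (hf t ht).continuousAt.continuousWithinAt
  have hmvt : ∀ s ∈ Icc (-δ) δ, ∀ t ∈ Icc (-δ) δ, s ≤ t → f t - f s ≤ -κ * (t - s) :=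
    (convex_Icc (-δ) δ).image_sub_le_mul_sub_of_deriv_le hcont
      (fun t ht => (hf t (interior_subset ht)).differentiableWithinAt)
      (fun t ht => hd t (interior_subset ht))
  have m0 : (0 : ℝ) ∈ Icc (-δ) δ := ⟨by linarith, hδ.le⟩
  have m1 : δ ∈ Icc (-δ) δ := ⟨by linarith, le_rfl⟩
  have m2 : -δ ∈ Icc (-δ) δ := ⟨le_rfl, by linarith⟩
  have h1 : f δ ≤ 0 := by
    have := hmvt 0 m0 δ m1 hδ.le
    have := (abs_lt.1 h0).2
    linarith
  have h2 : 0 ≤ f (-δ) := by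
    have := hmvt (-δ) m2 0 m0 (by linarith)
    have := (abs_lt.1 h0).1
    linarith
  obtain ⟨t, ht, hft⟩ := intermediate_value_Icc' (by linarith : -δ ≤ δ) hcont ⟨h1, h2⟩
  refine ⟨t, ⟨ht, hft⟩, ?_⟩
  rintro s ⟨hs, hfs⟩
  rcases lt_trichotomy s t with h | h | h
  · have := hmvt s hs t ht h.le
    nlinarith
  · exact h
  · have := hmvt t ht s hs h.le
    nlinarith

/-- Hoeffding's inequality for independent finitely valued observations. -/
theorem pi_real_abs_average_sub_ge_le {β : Type*} [Fintype β] [MeasurableSpace β]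
    [MeasurableSingletonClass β] {n : ℕ} (hn : 0 < n) (μ : Fin n → Measure β)
    [∀ i, IsProbabilityMeasure (μ i)] {f : Fin n → β → ℝ} {B ε : ℝ} (hB : 0 < B)
    (hf : ∀ i b, |f i b| ≤ B) (hε : 0 ≤ ε) :
    (Measure.pi μ).real {z | ε ≤ |(1 / (n : ℝ)) * ∑ i, f i (z i) -
      (1 / (n : ℝ)) * ∑ i, ∑ b, (μ i).real {b} * f i b|}
      ≤ 2 * Real.exp (-(ε ^ 2 / (2 * B ^ 2)) * n) := by
  have hn' : (0 : ℝ) < n := by exact_mod_cast hn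
  have hmean : ∀ i, ∫ b, f i b ∂(μ i) = ∑ b, (μ i).real {b} * f i b := fun i => by
    rw [integral_fintype (Integrable.of_finite)]
    simp
  have one_sided : ∀ g : Fin n → β → ℝ, (∀ i b, |g i b| ≤ B) →
      (Measure.pi μ).real {z | n * ε ≤ ∑ i, (g i (z i) - ∫ b, g i b ∂(μ i))}
        ≤ Real.exp (-(ε ^ 2 / (2 * B ^ 2)) * n) := by
    intro g hg
    have hind : iIndepFun (fun i (z : Fin n → β) => g i (z i) - ∫ b, g i b ∂(μ i))
        (Measure.pi μ) :=
      iIndepFun_pi (X := fun i b => g i b - ∫ b, g i b ∂(μ i))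
        (fun i => (measurable_of_finite _).aemeasurable)
    -- A variable with values in `[-B, B]` has variance proxy `((B - (-B))/2)² = B²`, whence the
    -- exponent `(nε)²/(2nB²)`.
    have hsub : ∀ i ∈ Finset.univ, HasSubgaussianMGF
        (fun z : Fin n → β => g i (z i) - ∫ b, g i b ∂(μ i)) ((‖B - -B‖₊ / 2) ^ 2)
        (Measure.pi μ) := by
      intro i _
      have h1 : HasSubgaussianMGF (fun b => g i b - ∫ b, g i b ∂(μ i)) ((‖B - -B‖₊ / 2) ^ 2)
          ((Measure.pi μ).map (fun z => z i)) := by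
        rw [(measurePreserving_eval μ i).map_eq]
        exact hasSubgaussianMGF_of_mem_Icc (measurable_of_finite _).aemeasurable
          (ae_of_all _ fun b => abs_le.1 (hg i b))
      have hm : Measurable fun z : Fin n → β => z i := measurable_pi_apply i
      exact h1.of_map hm.aemeasurable
    refine (HasSubgaussianMGF.measure_sum_ge_le_of_iIndepFun hind hsub
      (by positivity : 0 ≤ n * ε)).trans (le_of_eq ?_)
    congr 1
    have : (((‖B - -B‖₊ / 2) ^ 2 : ℝ≥0) : ℝ) = B ^ 2 := by
      simp only [NNReal.coe_pow, NNReal.coe_div, coe_nnnorm, Real.norm_eq_abs, NNReal.coe_ofNat]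
      rw [abs_of_pos (by linarith)]
      ring
    simp only [Finset.sum_const, Finset.card_univ, Fintype.card_fin, nsmul_eq_mul, NNReal.coe_mul,
      NNReal.coe_natCast, this]
    field_simp
  have h1 := one_sided f hf
  have h2 := one_sided (fun i b => -f i b) fun i b => by rw [abs_neg]; exact hf i b
  calc (Measure.pi μ).real {z | ε ≤ |(1 / (n : ℝ)) * ∑ i, f i (z i) -
      (1 / (n : ℝ)) * ∑ i, ∑ b, (μ i).real {b} * f i b|}
      ≤ (Measure.pi μ).real ({z | n * ε ≤ ∑ i, (f i (z i) - ∫ b, f i b ∂(μ i))} ∪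
        {z | n * ε ≤ ∑ i, (-f i (z i) - ∫ b, -f i b ∂(μ i))}) := by
        refine measureReal_mono fun z hz => ?_
        simp only [mem_ofPred_eq, ← hmean, ← mul_sub, ← Finset.sum_sub_distrib, abs_mul,
          abs_of_pos (show (0 : ℝ) < 1 / n by positivity)] at hz
        rw [one_div, inv_mul_eq_div, le_div_iff₀ hn', mul_comm, le_abs] at hz
        refine hz.imp (fun h => h) fun h => ?_
        simp only [mem_ofPred_eq, integral_neg]
        refine h.trans (le_of_eq ?_)
        rw [← Finset.sum_neg_distrib]
        exact Finset.sum_congr rfl fun i _ => by ring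
    _ ≤ _ := (measureReal_union_le _ _).trans (by linarith)

/-! ### The information identity, and the score equation for fixed covariates. -/

section Empirical

variable {d n : ℕ} (x : Fin n → Cov d)

theorem empirical_prod_count : (empirical x).prod
    ((Measure.count : Measure (Fin 2)).prod (Measure.count : Measure (Fin 2))) =
    (n : ℝ≥0∞)⁻¹ • Measure.sum fun p : Fin n × (Fin 2 × Fin 2) => Measure.dirac (x p.1, p.2) := by
  rw [empirical, Measure.prod_smul_left, ← Measure.sum_fintype, Measure.count, Measure.prod_sum,
    Measure.prod_sum]
  simp only [Measure.dirac_prod_dirac]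

theorem integral_Ptilde_empirical {U : Nuis d} (hU : ∀ a y k, 0 ≤ pU U a y k) (f : Obs d → ℝ) :
    ∫ o, f o ∂(Ptilde (empirical x) U) =
      (1 / (n : ℝ)) * ∑ i, ∑ b : Fin 2 × Fin 2, pU U b.1 b.2 (x i) * f (x i, b) := by
  rw [Ptilde, integral_withDensity_eq_integral_toReal_smul₀, empirical_prod_count,
    integral_smul_measure, Measure.sum_fintype, integral_finsetSum_measure]
  · simp [integral_dirac, Fintype.sum_prod_type, hU]
  · intro i _
    exact integrable_dirac (by simpa using ENNReal.mul_lt_top ENNReal.ofReal_lt_top enorm_lt_top)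
  · rw [empirical_prod_count]
    exact (AEMeasurable.sum_measure fun _ => aemeasurable_dirac).smul_measure _
  · simp

end Empirical

theorem sum_pU {d : ℕ} (U : Nuis d) (k : Cov d) :
    ∑ b : Fin 2 × Fin 2, pU U b.1 b.2 k = 1 := by
  simp [Fintype.sum_prod_type, pU, qa]
  ring

section Score

variable {d n : ℕ} {lam : ℝ → ℝ} {c η : ℝ} {x : Fin n → Cov d} {U : ℝ → Nuis d}

/-- The information identity along the path. -/
theorem PathAt.sum_pU_mul_deriv_Dstar (h : PathAt lam c η x U) (hw : RegularWeight lam c η)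
    (hn : 0 < n) (k : Cov d) {t : ℝ} (ht : t ∈ Ioo (-t1 c) (t1 c)) :
    ∑ b : Fin 2 × Fin 2, pU (U t) b.1 b.2 k *
      deriv (fun s => Dstar lam (empirical x) (U s) (k, b)) t =
    -∑ b : Fin 2 × Fin 2, pU (U t) b.1 b.2 k * Dstar lam (empirical x) (U t) (k, b) ^ 2 := by
  have hp : ∀ s ∈ Ioo (-t1 c) (t1 c), ∀ b : Fin 2 × Fin 2,
      HasDerivAt (fun s => pU (U s) b.1 b.2 k)
        (pU (U s) b.1 b.2 k * Dstar lam (empirical x) (U s) (k, b)) s :=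
    fun s hs b => h.hasDerivAt_pU hn hs b.1 b.2 k
  -- The score has mean zero under its own law because the total mass `∑ p = 1` has derivative `∑ p
  -- D*`.
  have hscore : ∀ s ∈ Ioo (-t1 c) (t1 c),
      ∑ b : Fin 2 × Fin 2, pU (U s) b.1 b.2 k * Dstar lam (empirical x) (U s) (k, b) = 0 := by
    intro s hs
    have h1 : HasDerivAt (fun s => ∑ b : Fin 2 × Fin 2, pU (U s) b.1 b.2 k) _ s :=
      HasDerivAt.fun_sum fun b _ => hp s hs b
    simp only [sum_pU] at h1
    exact h1.unique (hasDerivAt_const s 1)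
  -- Differentiating the mean-zero identity once more gives `∑ p (D*)² + ∑ p ∂D* = 0`.
  have h2 : HasDerivAt (fun s => ∑ b : Fin 2 × Fin 2,
      pU (U s) b.1 b.2 k * Dstar lam (empirical x) (U s) (k, b)) _ t :=
    HasDerivAt.fun_sum fun b _ =>
      (hp t ht b).fun_mul ((h.bddC11_Dstar hw hn k b).diff t ht).hasDerivAt
  have h3 : deriv (fun s => ∑ b : Fin 2 × Fin 2,
      pU (U s) b.1 b.2 k * Dstar lam (empirical x) (U s) (k, b)) t = 0 := by
    rw [(Filter.eventuallyEq_of_mem (Ioo_mem_nhds ht.1 ht.2) hscore).deriv_eq]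
    simp
  rw [h2.deriv, Finset.sum_add_distrib] at h3
  rw [eq_neg_iff_add_eq_zero, ← h3, add_comm]
  congr 1
  exact Finset.sum_congr rfl fun b _ => by ring

theorem PathAt.deriv_bound (h : PathAt lam c η x U) (hw : RegularWeight lam c η)
    (hn : 0 < n) (k : Cov d) (b : Fin 2 × Fin 2) {t : ℝ} (ht : t ∈ Ioo (-t1 c) (t1 c)) :
    |deriv (fun s => Dstar lam (empirical x) (U s) (k, b)) t| ≤ 45 * c⁻¹ ^ 10 :=
  ((h.bddC11_Dstar hw hn k b).bound_deriv t ht).trans (le_of_eq (by ring))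

end Score

section Bracketing

variable {d n : ℕ} {Pstar : Measure (Obs d)} {pc : Kernel (Cov d) (Fin 2 × Fin 2)}
  {lam : ℝ → ℝ} {x : Fin n → Cov d} {U0 : Nuis d} {U : ℝ → Nuis d} {c cinit η : ℝ}

theorem LocalBracketing.pos (h : LocalBracketing Pstar pc lam (empirical x) U0 c cinit) :
    0 < c ∧ c < 1 / 4 := by
  obtain ⟨η, hp, hr, -⟩ := h
  exact ⟨hr.1.1, (hp.regularWeight hr).lt_quarter⟩

theorem LocalBracketing.nondegenerate
    (h : LocalBracketing Pstar pc lam (empirical x) U0 c cinit) :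
    cinit ≤ (1 / (n : ℝ)) * ∑ i, ∑ b : Fin 2 × Fin 2,
      pU U0 b.1 b.2 (x i) * Dstar lam (empirical x) U0 (x i, b) ^ 2 := by
  obtain ⟨η, hp, hr, ⟨-, -, h⟩, -⟩ := h
  have hR : RegularAt lam c η U0 := ⟨hp.regularWeight hr, hp.valuesIn (by simpa using hp.1.1.le)⟩
  rwa [integral_Ptilde_empirical x fun a y k => (hR.pU_pos a y k).le] at h

theorem LocalBracketing.closeness
    (h : LocalBracketing Pstar pc lam (empirical x) U0 c cinit) :
    (1 / (n : ℝ)) * ∑ i, ∑ b : Fin 2 × Fin 2, |(pc (x i)).real {b} - pU U0 b.1 b.2 (x i)|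
      ≤ c ^ 10 * cinit / 300 := by
  obtain ⟨η, -, -, -, ⟨-, h⟩, -⟩ := h
  rw [integral_empirical, ← Finset.mul_sum] at h
  simp only [Fintype.sum_prod_type]
  linarith

theorem LocalBracketing.bias
    (h : LocalBracketing Pstar pc lam (empirical x) U0 c cinit) :
    |(1 / (n : ℝ)) * ∑ i, ∑ b : Fin 2 × Fin 2,
      (pc (x i)).real {b} * Dstar lam (empirical x) U0 (x i, b)|
      ≤ cinit * deltaInit c cinit / 8 := by
  obtain ⟨η, -, -, -, -, h⟩ := h
  rw [integral_empirical] at h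
  simpa only [Fintype.sum_prod_type, mul_comm (Dstar _ _ _ _)] using h

/-- Under `p_{U_0}` the mean of `∂D*` is minus the information, at most `-cinit`. Passing to `p*`
costs at most `45 c⁻¹⁰ * c¹⁰ cinit / 300 = 3 cinit / 20`, the factor `1/2` of total variation having
turned `600` into `300`. -/
theorem LocalBracketing.mean_curvature
    (h : LocalBracketing Pstar pc lam (empirical x) U0 c cinit)
    (hP : PathAt lam c η x U) (hw : RegularWeight lam c η) (hU0 : U 0 = U0) (hn : 0 < n) :
    (1 / (n : ℝ)) * ∑ i, ∑ b : Fin 2 × Fin 2, (pc (x i)).real {b} *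
      deriv (fun s => Dstar lam (empirical x) (U s) (x i, b)) 0 ≤ -(17 / 20 * cinit) := by
  have hn' : (0 : ℝ) < n := by exact_mod_cast hn
  have hc := hP.pos
  have m0 : (0 : ℝ) ∈ Ioo (-t1 c) (t1 c) := ⟨by linarith [t1_pos hc], t1_pos hc⟩
  have h1 : ∀ i, ∑ b : Fin 2 × Fin 2, (pc (x i)).real {b} *
      deriv (fun s => Dstar lam (empirical x) (U s) (x i, b)) 0 ≤
      -(∑ b : Fin 2 × Fin 2, pU U0 b.1 b.2 (x i) * Dstar lam (empirical x) U0 (x i, b) ^ 2) +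
      45 * c⁻¹ ^ 10 * ∑ b : Fin 2 × Fin 2, |(pc (x i)).real {b} - pU U0 b.1 b.2 (x i)| := by
    intro i
    have hs := hP.sum_pU_mul_deriv_Dstar hw hn (x i) m0
    rw [hU0] at hs
    rw [← hs, Finset.mul_sum, ← Finset.sum_add_distrib]
    refine Finset.sum_le_sum fun b _ => ?_
    have hb := hP.deriv_bound hw hn (x i) b m0
    rw [← sub_le_iff_le_add', ← sub_mul, mul_comm (45 * c⁻¹ ^ 10)]
    refine (le_abs_self _).trans ?_
    rw [abs_mul]
    gcongr
  calc _ ≤ (1 / (n : ℝ)) * ∑ i, (-(∑ b : Fin 2 × Fin 2,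
          pU U0 b.1 b.2 (x i) * Dstar lam (empirical x) U0 (x i, b) ^ 2) +
        45 * c⁻¹ ^ 10 * ∑ b : Fin 2 × Fin 2, |(pc (x i)).real {b} - pU U0 b.1 b.2 (x i)|) := by
        gcongr with i
        exact h1 i
    _ = -((1 / (n : ℝ)) * ∑ i, ∑ b : Fin 2 × Fin 2,
          pU U0 b.1 b.2 (x i) * Dstar lam (empirical x) U0 (x i, b) ^ 2) +
        45 * c⁻¹ ^ 10 * ((1 / (n : ℝ)) * ∑ i, ∑ b : Fin 2 × Fin 2,
          |(pc (x i)).real {b} - pU U0 b.1 b.2 (x i)|) := by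
        rw [Finset.sum_add_distrib, Finset.sum_neg_distrib, ← Finset.mul_sum]
        ring
    _ ≤ -cinit + 45 * c⁻¹ ^ 10 * (c ^ 10 * cinit / 300) := by
        gcongr
        exacts [h.nondegenerate, h.closeness]
    _ = -(17 / 20 * cinit) := by
        field_simp
        ring

theorem deltaInit_pos (hc : 0 < c) (hi : 0 < cinit) : 0 < deltaInit c cinit := by
  unfold deltaInit
  positivity

theorem deltaInit_lt (hc : 0 < c) (hc4 : c < 1 / 4) (hi : cinit ∈ Ioo (0 : ℝ) 1) :
    deltaInit c cinit < t1 c / 2 := by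
  unfold deltaInit t1
  have h1 : c ^ 20 ≤ c ^ 6 := pow_le_pow_of_le_one hc.le (by linarith) (by norm_num)
  have h2 : 0 < c ^ 6 := by positivity
  have h3 : cinit * c ^ 20 ≤ 1 * c ^ 6 := by
    have := hi.2
    gcongr
  linarith

/-- If the score and its derivative at the origin are close to their conditional means, then the
score has exactly one zero near the origin. -/
theorem LocalBracketing.existsUnique_zero
    (h : LocalBracketing Pstar pc lam (empirical x) U0 c cinit) (hi : cinit ∈ Ioo (0 : ℝ) 1)
    (hP : PathAt lam c η x U) (hw : RegularWeight lam c η) (hU0 : U 0 = U0) (hn : 0 < n)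
    (z : Fin n → Fin 2 × Fin 2)
    (h0 : |(1 / (n : ℝ)) * ∑ i, Dstar lam (empirical x) U0 (x i, z i) -
      (1 / (n : ℝ)) * ∑ i, ∑ b : Fin 2 × Fin 2,
        (pc (x i)).real {b} * Dstar lam (empirical x) U0 (x i, b)|
      < cinit * deltaInit c cinit / 16)
    (h1 : |(1 / (n : ℝ)) * ∑ i, deriv (fun s => Dstar lam (empirical x) (U s) (x i, z i)) 0 -
      (1 / (n : ℝ)) * ∑ i, ∑ b : Fin 2 × Fin 2, (pc (x i)).real {b} *
        deriv (fun s => Dstar lam (empirical x) (U s) (x i, b)) 0|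
      < cinit * deltaInit c cinit / 16) :
    ∃! t, t ∈ Icc (-deltaInit c cinit) (deltaInit c cinit) ∧
      (1 / (n : ℝ)) * ∑ i, Dstar lam (empirical x) (U t) (x i, z i) = 0 := by
  have hc := hP.pos
  have hci := hi.1
  have hδ := deltaInit_pos hc hi.1
  have hδt := deltaInit_lt hc hP.lt hi
  have ht1 := t1_pos hc
  have m0 : (0 : ℝ) ∈ Ioo (-t1 c) (t1 c) := ⟨by linarith, ht1⟩
  have hI : ∀ t ∈ Icc (-deltaInit c cinit) (deltaInit c cinit), t ∈ Ioo (-t1 c) (t1 c) :=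
    fun t ht => ⟨by linarith [ht.1], by linarith [ht.2]⟩
  have hS := BddC11.average hn fun i => hP.bddC11_Dstar hw hn (x i) (z i)
  set S : ℝ → ℝ := fun t => (1 / (n : ℝ)) * ∑ i, Dstar lam (empirical x) (U t) (x i, z i)
  have hS0 : deriv S 0 =
      (1 / (n : ℝ)) * ∑ i, deriv (fun s => Dstar lam (empirical x) (U s) (x i, z i)) 0 :=
    ((HasDerivAt.fun_sum fun i _ =>
      ((hP.bddC11_Dstar hw hn (x i) (z i)).diff 0 m0).hasDerivAt).const_mul _).deriv
  have hδ1 : deltaInit c cinit ≤ 1 := by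
    have : t1 c ≤ 1 := by
      unfold t1
      have : c ^ 6 ≤ 1 := pow_le_one₀ hc.le (by linarith [hP.lt])
      linarith
    linarith
  -- Slope: `-17/20 + 1/16 + 1/100 < -1/2`, in units of `cinit`. Value at the origin: `1/8 + 1/16 <
  -- 1/2`, in units of `cinit * δ_init`.
  refine existsUnique_zero_of_deriv_le (κ := cinit / 2) (by linarith) hδ
    (fun t ht => hS.diff t (hI t ht)) (fun t ht => ?_) ?_
  · have hlip := hS.lip t (hI t ht) 0 m0
    have ht' : |t - 0| ≤ deltaInit c cinit := by rw [sub_zero]; exact abs_le.2 ht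
    -- The Lipschitz constant of the slope is `2700 c⁻¹⁸`. The factors `c²⁰` and `10⁶` in `δ_init`
    -- make the change of slope over the interval negligible.
    have hb : 3 * c⁻¹ ^ 4 * (4 * c⁻¹ ^ 2 * (15 * c⁻¹ ^ 6) ^ 2) * |t - 0| ≤ cinit / 100 := by
      calc _ ≤ 3 * c⁻¹ ^ 4 * (4 * c⁻¹ ^ 2 * (15 * c⁻¹ ^ 6) ^ 2) * deltaInit c cinit := by gcongr
        _ = 27 / 10000 * c ^ 2 * cinit := by
          unfold deltaInit
          field_simp
          norm_num
        _ ≤ 27 / 10000 * 1 * cinit := by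
          have : c ^ 2 ≤ 1 := pow_le_one₀ hc.le (by linarith [hP.lt])
          gcongr
        _ ≤ cinit / 100 := by linarith
    have hm := h.mean_curvature hP hw hU0 hn
    rw [← hS0] at h1
    have h2 := (abs_lt.1 h1).2
    have h3 := (abs_le.1 (hlip.trans hb)).2
    have h4 : cinit * deltaInit c cinit ≤ cinit * 1 := by gcongr
    linarith
  · have hb := abs_le.1 h.bias
    have h2 := abs_lt.1 h0
    have hpos : 0 < cinit * deltaInit c cinit := by positivity
    simp only [hU0]
    exact abs_lt.2 ⟨by linarith, by linarith⟩

/-- The conditional probability that the score fails to have exactly one zero near the origin. -/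
theorem LocalBracketing.pi_real_not_existsUnique_le [IsMarkovKernel pc]
    (h : LocalBracketing Pstar pc lam (empirical x) U0 c cinit) (hi : cinit ∈ Ioo (0 : ℝ) 1)
    (hU : IsPath lam (empirical x) U0 c U) (hn : 0 < n) :
    (Measure.pi fun i => pc (x i)).real {z | ¬ ∃! t,
      t ∈ Icc (-deltaInit c cinit) (deltaInit c cinit) ∧
      (1 / (n : ℝ)) * ∑ i, Dstar lam (empirical x) (U t) (x i, z i) = 0}
      ≤ 4 * Real.exp (-((cinit * deltaInit c cinit / 16) ^ 2 / (2 * (45 * c⁻¹ ^ 10) ^ 2)) * n) := by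
  obtain ⟨η, hw, hP⟩ := hU.exists_pathAt hn
  have hc := hP.pos
  have hci := hi.1
  have hδ := deltaInit_pos hc hi.1
  have hz := hP.four_le_inv
  have m0 : (0 : ℝ) ∈ Ioo (-t1 c) (t1 c) := ⟨by linarith [t1_pos hc], t1_pos hc⟩
  have hε : 0 ≤ cinit * deltaInit c cinit / 16 := by positivity
  have hB : 0 < 45 * c⁻¹ ^ 10 := by positivity
  have b0 : ∀ i b, |Dstar lam (empirical x) U0 (x i, b)| ≤ 45 * c⁻¹ ^ 10 := fun i b => by
    have := (hP.bddC11_Dstar hw hn (x i) b).bound 0 m0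
    rw [hU.1] at this
    -- The bound on `∂D*` also dominates `D*`, so both Hoeffding bounds share one exponent and add
    -- up to the prefactor `4`.
    refine this.trans ?_
    have h4 : c⁻¹ ^ 4 ≤ c⁻¹ ^ 10 := pow_le_pow_right₀ (by linarith) (by norm_num)
    have : 0 < c⁻¹ ^ 10 := by positivity
    linarith
  have e0 := pi_real_abs_average_sub_ge_le hn (fun i => pc (x i)) hB b0 hε
  have e1 := pi_real_abs_average_sub_ge_le hn (fun i => pc (x i)) hB
    (fun i b => hP.deriv_bound hw hn (x i) b m0) hε
  refine (measureReal_mono fun z hz => ?_).trans ((measureReal_union_le _ _).trans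
    ((add_le_add e0 e1).trans (le_of_eq (by ring))))
  by_contra hcon
  simp only [mem_union, mem_ofPred_eq, not_or, not_le] at hcon
  exact hz (h.existsUnique_zero hi hP hw hU.1 hn z hcon.1 hcon.2)

end Bracketing

/-! ### Measurability of events about zeros of random functions. -/

section MeasurableZeros

variable {Om : Type*} {mOm : MeasurableSpace Om} {An : Set Om} {f F : Om → ℝ → ℝ} {a b : ℝ}

/-- By compactness `|f|` attains its minimum, so a zero exists exactly when rational points make
`|f|` smaller than every `1/(k+1)`. The measurable `F` stands in for `f`, with which it has to agree
only on `An`. -/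
theorem measurableSet_exists_zero (hAn : MeasurableSet An)
    (hF : ∀ t ∈ Icc a b, Measurable fun w => F w t)
    (hFf : ∀ w ∈ An, ∀ t ∈ Icc a b, F w t = f w t)
    (hf : ∀ w ∈ An, ContinuousOn (f w) (Icc a b)) (hab : a < b) :
    MeasurableSet {w | w ∈ An ∧ ∃ t ∈ Icc a b, f w t = 0} := by
  have key : {w | w ∈ An ∧ ∃ t ∈ Icc a b, f w t = 0} =
      An ∩ ⋂ k : ℕ, ⋃ q : {q : ℚ // (q : ℝ) ∈ Icc a b}, {w | |F w q| < 1 / ((k : ℝ) + 1)} := by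
    ext w
    simp only [mem_ofPred_eq, mem_inter_iff, mem_iInter, mem_iUnion]
    refine and_congr_right fun hw => ⟨?_, fun h => ?_⟩
    · rintro ⟨t, ht, h0⟩ k
      -- Approximation by rationals of the open interval also covers a zero at an end point.
      have hcl : t ∈ closure (Ioo a b ∩ range ((↑) : ℚ → ℝ)) := by
        have h1 := closure_mono (Dense.open_subset_closure_inter
          (Rat.denseRange_cast (𝕜 := ℝ)) (isOpen_Ioo (a := a) (b := b)))
        rw [closure_Ioo hab.ne, closure_closure] at h1
        exact h1 ht
      have hc : ContinuousWithinAt (f w) (Ioo a b ∩ range ((↑) : ℚ → ℝ)) t :=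
        (hf w hw t ht).mono (inter_subset_left.trans Ioo_subset_Icc_self)
      have : (nhdsWithin t (Ioo a b ∩ range ((↑) : ℚ → ℝ))).NeBot :=
        mem_closure_iff_nhdsWithin_neBot.1 hcl
      have hev : ∀ᶠ s in nhdsWithin t (Ioo a b ∩ range ((↑) : ℚ → ℝ)),
          |f w s| < 1 / ((k : ℝ) + 1) := by
        have h2 := hc.abs
        rw [ContinuousWithinAt, h0, abs_zero] at h2
        exact h2.eventually_lt_const (by positivity)
      obtain ⟨s, hs, hsm, q, rfl⟩ := (hev.and self_mem_nhdsWithin).exists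
      refine ⟨⟨q, Ioo_subset_Icc_self hsm⟩, ?_⟩
      rwa [hFf w hw _ (Ioo_subset_Icc_self hsm)]
    · obtain ⟨t, ht, hmin⟩ := isCompact_Icc.exists_isMinOn (nonempty_Icc.2 hab.le) (hf w hw).abs
      refine ⟨t, ht, ?_⟩
      by_contra hne
      obtain ⟨k, hk⟩ := exists_nat_one_div_lt (abs_pos.2 hne)
      obtain ⟨⟨q, hq⟩, hqk⟩ := h k
      have h1 : |f w t| ≤ |f w q| := hmin hq
      rw [hFf w hw _ hq] at hqk
      linarith
  rw [key]
  refine hAn.inter (MeasurableSet.iInter fun k => MeasurableSet.iUnion fun q => ?_)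
  exact measurableSet_lt (hF q q.2).abs measurable_const

theorem measurableSet_existsUnique_zero (hAn : MeasurableSet An)
    (hF : ∀ t ∈ Icc a b, Measurable fun w => F w t)
    (hFf : ∀ w ∈ An, ∀ t ∈ Icc a b, F w t = f w t)
    (hf : ∀ w ∈ An, ContinuousOn (f w) (Icc a b)) (hab : a < b) :
    MeasurableSet {w | w ∈ An ∧ ∃! t, t ∈ Icc a b ∧ f w t = 0} := by
  have hZ : ∀ r s, a ≤ r → s ≤ b → r < s →
      MeasurableSet {w | w ∈ An ∧ ∃ t ∈ Icc r s, f w t = 0} := fun r s hr hs hrs =>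
    measurableSet_exists_zero hAn (fun t ht => hF t (Icc_subset_Icc hr hs ht))
      (fun w hw t ht => hFf w hw t (Icc_subset_Icc hr hs ht))
      (fun w hw => (hf w hw).mono (Icc_subset_Icc hr hs)) hrs
  -- Two distinct zeros are separated by two rationals `q < r`. A single rational would not do,
  -- since a zero at that rational would be counted on both sides.
  have key : {w | w ∈ An ∧ ∃! t, t ∈ Icc a b ∧ f w t = 0} =
      {w | w ∈ An ∧ ∃ t ∈ Icc a b, f w t = 0} \
        ⋃ p : {p : ℚ × ℚ // a < p.1 ∧ (p.1 : ℝ) < p.2 ∧ (p.2 : ℝ) < b},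
          {w | w ∈ An ∧ ∃ t ∈ Icc a (p.1.1 : ℝ), f w t = 0} ∩
          {w | w ∈ An ∧ ∃ t ∈ Icc (p.1.2 : ℝ) b, f w t = 0} := by
    ext w
    simp only [mem_ofPred_eq, mem_sdiff, mem_iUnion, mem_inter_iff, not_exists]
    constructor
    · rintro ⟨hw, t, ⟨ht, h0⟩, huniq⟩
      refine ⟨⟨hw, t, ht, h0⟩, ?_⟩
      rintro ⟨⟨q, r⟩, h1, h2, h3⟩ ⟨⟨-, s, hs, hs0⟩, -, s', hs', hs0'⟩
      dsimp only at h1 h2 h3 hs hs'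
      have e1 := huniq s ⟨⟨hs.1, by linarith [hs.2]⟩, hs0⟩
      have e2 := huniq s' ⟨⟨by linarith [hs'.1], hs'.2⟩, hs0'⟩
      have := hs.2
      have := hs'.1
      linarith
    · rintro ⟨⟨hw, t, ht, h0⟩, hno⟩
      refine ⟨hw, t, ⟨ht, h0⟩, ?_⟩
      have no_pair : ∀ s ∈ Icc a b, ∀ s' ∈ Icc a b, f w s = 0 → f w s' = 0 → ¬ s < s' := by
        intro s hs s' hs' h1 h2 hlt
        obtain ⟨q, hq1, hq2⟩ := exists_rat_btwn hlt
        obtain ⟨r, hr1, hr2⟩ := exists_rat_btwn hq2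
        refine hno ⟨(q, r), ?_, hr1, ?_⟩ ⟨⟨hw, s, ⟨hs.1, hq1.le⟩, h1⟩, hw, s', ⟨hr2.le, hs'.2⟩, h2⟩
        · exact hs.1.trans_lt hq1
        · exact hr2.trans_le hs'.2
      rintro s ⟨hs, hs0⟩
      exact le_antisymm (not_lt.1 (no_pair t ht s hs h0 hs0)) (not_lt.1 (no_pair s hs t ht hs0 h0))
  rw [key]
  refine (hZ a b le_rfl le_rfl hab).diff (MeasurableSet.iUnion fun p => ?_)
  obtain ⟨⟨q, r⟩, h1, h2, h3⟩ := p
  exact (hZ a q le_rfl (h2.trans h3).le h1).inter (hZ r b (h1.trans h2).le le_rfl h3)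

/-- Second countability of `E` makes open subsets of `E × X` measurable for the product σ-field. -/
theorem measurable_comp_of_continuous_prod {E X : Type*} [TopologicalSpace E]
    [SecondCountableTopology E] [TopologicalSpace X] [MeasurableSpace X] [OpensMeasurableSpace X]
    {H : E × X → ℝ} (hH : Continuous H) {u : Om → E} (hu : @Measurable _ _ mOm (borel E) u)
    {v : Om → X} (hv : Measurable v) : Measurable fun w => H (u w, v w) := by
  let _ : MeasurableSpace E := borel E
  have : BorelSpace E := ⟨rfl⟩
  exact hH.measurable.comp (Measurable.prodMk hu hv)

end MeasurableZeros

/-! ### Dependence of the score on the initial triple and the sample points. -/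

section Restriction

variable {d n : ℕ}

/-- The triple of values of `U` at the sample points, as a triple on a finite discrete space. -/
def restrictTo (x : Fin n → Cov d) (U : Nuis d) : Triple (Fin n) :=
  (U.1.comp ⟨x, continuous_of_discreteTopology⟩, U.2.1.comp ⟨x, continuous_of_discreteTopology⟩,
    U.2.2.comp ⟨x, continuous_of_discreteTopology⟩)

theorem continuous_comp_eval (g : Nuis d → C(Cov d, ℝ)) (hg : Continuous g) :
    Continuous fun p : Nuis d × (Fin n → Cov d) =>
      ((g p.1).comp ⟨p.2, continuous_of_discreteTopology⟩ : C(Fin n, ℝ)) := by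
  refine ContinuousMap.continuous_of_continuous_uncurry _ ?_
  rw [continuous_prod_of_discrete_right]
  intro i
  change Continuous fun p : Nuis d × (Fin n → Cov d) => g p.1 (p.2 i)
  have h1 : Continuous fun p : Nuis d × (Fin n → Cov d) => g p.1 := hg.comp continuous_fst
  have h2 : Continuous fun p : Nuis d × (Fin n → Cov d) => p.2 i :=
    (continuous_apply i).comp continuous_snd
  exact continuous_eval.comp (h1.prodMk h2)

theorem continuous_restrictTo :
    Continuous fun p : Nuis d × (Fin n → Cov d) => restrictTo p.2 p.1 :=
  (continuous_comp_eval _ continuous_fst).prodMk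
    ((continuous_comp_eval _ (continuous_fst.comp continuous_snd)).prodMk
      (continuous_comp_eval _ (continuous_snd.comp continuous_snd)))

/-- Restriction to the sample points as a continuous linear map. -/
def restrictCLM (x : Fin n → Cov d) : Nuis d →L[ℝ] Triple (Fin n) where
  toFun := restrictTo x
  map_add' _ _ := rfl
  map_smul' _ _ := rfl
  cont := continuous_restrictTo.comp (continuous_id.prodMk continuous_const)

variable {lam g0 g1 : ℝ → ℝ} {c : ℝ}

/-- The score expressed through the values at the sample points. -/
noncomputable def sampleScore (g0 g1 : ℝ → ℝ) (c : ℝ) (W : Triple (Fin n)) (i : Fin n)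
    (b : Fin 2 × Fin 2) : ℝ :=
  g0 (W.2.2 i) * (sampleOmega g0 id W)⁻¹ *
      (((b.1 : ℕ) : ℝ) * (clamp c (1 - c) (W.2.2 i))⁻¹ * (((b.2 : ℕ) : ℝ) - W.1 i)
        - (1 - ((b.1 : ℕ) : ℝ)) * (1 - clamp c (1 - c) (W.2.2 i))⁻¹ *
          (((b.2 : ℕ) : ℝ) - W.2.1 i))
    + g1 (W.2.2 i) * (sampleOmega g0 id W)⁻¹ * (clampTau W i - samplePsi g0 id W)
      * (((b.1 : ℕ) : ℝ) - W.2.2 i)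

theorem BddLip.continuous {E : Type*} [PseudoMetricSpace E] {f : E → ℝ} {B M : ℝ}
    (h : BddLip f B M) : Continuous f := by
  have := h.bound_nonneg
  have := h.nonneg
  exact (LipschitzWith.of_dist_le_mul (K := NNReal.mk (B * M) (by positivity))
    fun x y => h.lip x y).continuous

theorem continuous_sampleScore (hg : IsWeightExtension lam c g0 g1) (hc : 0 < c)
    (hc4 : c < 1 / 4) (hn : 0 < n) (i : Fin n) (b : Fin 2 × Fin 2) :
    Continuous fun W : Triple (Fin n) => sampleScore g0 g1 c W i b := by
  have e1 : Continuous fun W : Triple (Fin n) => W.1 i :=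
    (continuous_eval_const i).comp continuous_fst
  have e2 : Continuous fun W : Triple (Fin n) => W.2.1 i :=
    (continuous_eval_const i).comp (continuous_fst.comp continuous_snd)
  have e3 : Continuous fun W : Triple (Fin n) => W.2.2 i :=
    (continuous_eval_const i).comp (continuous_snd.comp continuous_snd)
  have h0 := (hg.bddLip_zero hc i).continuous
  have h1 := (hg.bddLip_one i).continuous
  have hΩ := (hg.bddLip_inv_sampleOmega (x := (id : Fin n → Fin n)) hc hn).continuous
  have hψ := (hg.bddLip_samplePsi (x := (id : Fin n → Fin n)) hc hn).continuous
  have hτ := (bddLip_clampTau i).continuous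
  have hcl := bddLip_clamp_snd_snd hc hc4 i
  have hi := (hcl.inv hc fun U => (clamp_mem (by linarith) _).1).continuous
  have hi' : Continuous fun W : Triple (Fin n) => (1 - clamp c (1 - c) (W.2.2 i))⁻¹ :=
    (continuous_const.sub hcl.continuous).inv₀ fun W => by
      have := (clamp_mem (show c ≤ 1 - c by linarith) (W.2.2 i)).2
      exact (by linarith : 0 < 1 - clamp c (1 - c) (W.2.2 i)).ne'
  exact ((h0.mul hΩ).mul (((continuous_const.mul hi).mul (continuous_const.sub e1)).sub
    ((continuous_const.mul hi').mul (continuous_const.sub e2)))).add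
    (((h1.mul hΩ).mul (hτ.sub hψ)).mul (continuous_const.sub e3))

theorem RegularAt.sampleScore_restrictTo {η : ℝ} {U : Nuis d} (h : RegularAt lam c η U)
    (hg : IsWeightExtension lam c g0 g1) (x : Fin n → Cov d) (i : Fin n) (b : Fin 2 × Fin 2) :
    sampleScore g0 g1 c (restrictTo x U) i b = Dstar lam (empirical x) U (x i, b) := by
  -- Evaluating the restricted triple at `id` is by definition evaluating `U` at `x`, so the earlier
  -- identities apply verbatim.
  have hΩ : sampleOmega g0 id (restrictTo x U) = Omega lam (empirical x) U := h.sampleOmega_eq hg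
  have hψ : samplePsi g0 id (restrictTo x U) = psi lam (empirical x) U := h.samplePsi_eq hg
  have hτ : clampTau (restrictTo x U) i = tau U (x i) := h.clampTau_eq (x i)
  have he : (restrictTo x U).2.2 i = U.2.2 (x i) := rfl
  have h1 : (restrictTo x U).1 i = U.1 (x i) := rfl
  have h0 : (restrictTo x U).2.1 i = U.2.1 (x i) := rfl
  obtain ⟨hg0, hg1⟩ := hg.eq η h.regular _ (h.ps_mem (x i))
  rw [sampleScore, hΩ, hψ, hτ, he, h1, h0, h.clamp_ps, hg0, hg1, Dstar, phi, add_sub_cancel_right]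
  simp only [div_eq_mul_inv, ps, q1, q0]

/-- For fixed labels and fixed time, the score at time `t` along the path is a continuous function
of the initial triple and the sample points. -/
theorem exists_continuous_score (lam : ℝ → ℝ) (hc : 0 < c) (hc4 : c < 1 / 4) (hn : 0 < n)
    (z : Fin n → Fin 2 × Fin 2) :
    ∃ H : ℝ → Nuis d × (Fin n → Cov d) → ℝ, ∀ t ∈ Ioo (-t1 c) (t1 c), Continuous (H t) ∧
      ∀ (x : Fin n → Cov d) (U0 : Nuis d) (U : ℝ → Nuis d), IsPath lam (empirical x) U0 c U →
        H t (U0, x) = (1 / (n : ℝ)) * ∑ i, Dstar lam (empirical x) (U t) (x i, z i) := by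
  obtain ⟨g0, g1, hg⟩ := exists_isWeightExtension (lam := lam) hc (by linarith)
  have hlip := lipschitzWith_truncField (x := (id : Fin n → Fin n)) hg hc hc4 hn
  choose φ hφ0 hφ using fun W : Triple (Fin n) => exists_solution_of_lipschitz_of_bounded
    (V := NNReal.mk (3 * c⁻¹ ^ 4) (by positivity)) hlip
    (norm_truncField_le (x := (id : Fin n → Fin n)) hg hc hc4 hn) (t1_pos hc) W
  refine ⟨fun t p => (1 / (n : ℝ)) * ∑ i, sampleScore g0 g1 c (φ (restrictTo p.2 p.1) t) i (z i),
    fun t ht => ⟨?_, ?_⟩⟩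
  · have hcont : Continuous fun W => φ W t := by
      refine (LipschitzWith.of_dist_le_mul (K := NNReal.mk
        (Real.exp ((NNReal.mk (9 * c⁻¹ ^ 6) (by positivity)) * |t|)) (by positivity))
        fun W W' => ?_).continuous
      have := dist_solution_le hlip (hφ W) (hφ W') ht
      rw [hφ0, hφ0, mul_comm] at this
      exact this
    exact continuous_const.mul (continuous_finsetSum _ fun i _ =>
      (continuous_sampleScore hg hc hc4 hn i (z i)).comp (hcont.comp continuous_restrictTo))
  · intro x U0 U hU
    obtain ⟨η, -, hP⟩ := hU.exists_pathAt hn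
    -- At a sample point the field involves only values at sample points, so the restricted path
    -- solves a closed equation on `Fin n`. That equation no longer contains `x`, which enters
    -- through the initial value alone; continuity in initial data is then enough.
    have hR : ∀ t ∈ Ioo (-t1 c) (t1 c), HasDerivAt (fun s => restrictTo x (U s))
        (truncField hg hc hc4 id (restrictTo x (U t))) t := fun t ht =>
      (restrictCLM x).hasFDerivAt.comp_hasDerivAt t (hU.hasDerivAt hg hc hc4 t ht)
    have heq := dist_solution_le hlip (hφ (restrictTo x U0)) hR ht
    rw [hφ0, hU.1, dist_self, zero_mul] at heq
    simp only [dist_le_zero.1 heq, (hP.regular t ht).sampleScore_restrictTo hg]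

end Restriction

/-! ### Conditional probability as a finite sum over labels. -/

theorem measureReal_eq_sum_indicator {α : Type*} [Fintype α] [MeasurableSpace α]
    [MeasurableSingletonClass α] (μ : Measure α) [IsFiniteMeasure μ] (s : Set α) :
    μ.real s = ∑ z, s.indicator (fun _ => (1 : ℝ)) z * μ.real {z} := by
  have h : ∫ z, s.indicator (fun _ => (1 : ℝ)) z ∂μ = μ.real s := by
    rw [integral_indicator (Set.toFinite s).measurableSet]
    simp
  rw [← h, integral_fintype Integrable.of_finite]
  simp [mul_comm]

/-- The conditional probability, given `G`, of an event determined by `G` and by conditionally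
independent labels. -/
theorem indicator_mul_condExp_compl_ae_eq {Om β : Type*} [Fintype β] [MeasurableSpace β]
    [MeasurableSingletonClass β] {n : ℕ} {G mOm : MeasurableSpace Om} (hG : G ≤ mOm)
    {P : Measure Om} [IsProbabilityMeasure P] {Z : Fin n → Om → β} {p : Fin n → Om → β → ℝ}
    (hZ : ∀ i, Measurable (Z i)) (hind : CondIndepGiven G P Z)
    (hp : ∀ i b, P⟦{w | Z i w = b} | G⟧ =ᵐ[P] fun w => p i w b)
    {An : Set Om} (hAn : MeasurableSet[G] An) {good : (Fin n → β) → Set Om}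
    (hgood : ∀ z, MeasurableSet[G] (good z)) {E : Set Om}
    (hE : ∀ w ∈ An, w ∈ E ↔ w ∈ good fun i => Z i w) (hEm : MeasurableSet E) :
    ∀ᵐ w ∂P, An.indicator (fun _ => (1 : ℝ)) w * (P⟦Eᶜ | G⟧) w =
      ∑ z : Fin n → β, (An \ good z).indicator (fun _ => (1 : ℝ)) w * ∏ i, p i w (z i) := by
  classical
  have hint : ∀ s : Set Om, MeasurableSet s → Integrable (s.indicator fun _ => (1 : ℝ)) P :=
    fun s hs => (integrable_const 1).indicator hs
  have hZm : ∀ z : Fin n → β, MeasurableSet {w | ∀ i, Z i w = z i} := fun z => by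
    rw [ofPred_forall]
    exact MeasurableSet.iInter fun i => hZ i (measurableSet_singleton (z i))
  have h1 := condExp_indicator (m := G) (hint Eᶜ hEm.compl) hAn
  -- Exactly one label vector `z` matches the observed labels, and for it membership in `E` is the
  -- `G`-measurable condition `good z`.
  have hsum : An.indicator (Eᶜ.indicator fun _ => (1 : ℝ)) = ∑ z : Fin n → β,
      (An \ good z).indicator ({w | ∀ i, Z i w = z i}.indicator fun _ => (1 : ℝ)) := by
    funext w
    rw [Finset.sum_apply, Finset.sum_eq_single (fun i => Z i w)]
    · by_cases hw : w ∈ An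
      · simp [indicator, hw, hE w hw]
      · simp [indicator, hw]
    · intro z _ hz
      have : ¬ ∀ i, Z i w = z i := fun h => hz (funext fun i => (h i).symm)
      simpa [indicator] using fun _ _ => not_forall.1 this
    · simp
  have h2 : P[An.indicator (Eᶜ.indicator fun _ => (1 : ℝ)) | G] =ᵐ[P] ∑ z : Fin n → β,
      P[(An \ good z).indicator ({w | ∀ i, Z i w = z i}.indicator fun _ => (1 : ℝ)) | G] := by
    rw [hsum]
    exact condExp_finsetSum (fun z _ => (hint _ (hZm z)).indicator
      ((hG _ hAn).diff (hG _ (hgood z)))) G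
  have h3 : ∀ z : Fin n → β,
      P[(An \ good z).indicator ({w | ∀ i, Z i w = z i}.indicator fun _ => (1 : ℝ)) | G]
      =ᵐ[P] (An \ good z).indicator (P⟦{w | ∀ i, Z i w = z i} | G⟧) := fun z =>
    condExp_indicator (hint _ (hZm z)) (hAn.diff (hgood z))
  have h4 : ∀ z : Fin n → β, P⟦{w | ∀ i, Z i w = z i} | G⟧ =ᵐ[P]
      fun w => ∏ i, p i w (z i) := by
    intro z
    have h := hind Finset.univ (fun i => {z i}) fun i _ => measurableSet_singleton (z i)
    have he : (⋂ i ∈ Finset.univ, Z i ⁻¹' {z i}) = {w | ∀ i, Z i w = z i} := by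
      ext w
      simp
    rw [he] at h
    filter_upwards [h, ae_all_iff.2 fun i => hp i (z i)] with w hw hpw
    rw [hw, Finset.prod_apply]
    exact Finset.prod_congr rfl fun i _ => hpw i
  filter_upwards [h1, h2, ae_all_iff.2 h3, ae_all_iff.2 h4] with w e1 e2 e3 e4
  have e5 : An.indicator (fun _ => (1 : ℝ)) w * (P⟦Eᶜ | G⟧) w = An.indicator (P⟦Eᶜ | G⟧) w := by
    by_cases hw : w ∈ An <;> simp [hw]
  rw [e5, ← e1, e2, Finset.sum_apply]
  refine Finset.sum_congr rfl fun z _ => ?_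
  rw [e3 z, ← e4 z]
  by_cases hw : w ∈ An \ good z
  · simp only [indicator_of_mem hw, one_mul]
  · simp only [indicator_of_notMem hw, zero_mul]

/-! ### The log-likelihood along the path. -/

section LogLikelihood

variable {d n : ℕ} {Om : Type*} {lam : ℝ → ℝ} {c : ℝ} {X : Fin n → Om → Cov d}
  {A Y : Fin n → Om → Fin 2} {U0 : Om → Nuis d} {An : Set Om} {w : Om}

theorem hasDerivAt_Ln (hn : 0 < n) (hw : w ∈ An)
    (hP : IsPath lam (empirical fun i => X i w) (U0 w) c
      (path lam (empirical fun i => X i w) (U0 w) c)) {t : ℝ} (ht : t ∈ Ioo (-t1 c) (t1 c)) :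
    HasDerivAt (Ln lam c X A Y U0 An w) ((1 / (n : ℝ)) * ∑ i, Dstar lam (empirical fun j => X j w)
      (path lam (empirical fun j => X j w) (U0 w) c t) (X i w, (A i w, Y i w))) t := by
  obtain ⟨η, -, h⟩ := hP.exists_pathAt hn
  have hL : Ln lam c X A Y U0 An w = fun t => (1 / (n : ℝ)) * ∑ i, Real.log
      (pU (path lam (empirical fun j => X j w) (U0 w) c t) (A i w) (Y i w) (X i w)) := by
    funext t
    rw [Ln, if_pos hw]
  rw [hL]
  exact (HasDerivAt.fun_sum fun i _ => h.hasDerivAt_log_pU hn ht _ _ _).const_mul _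

theorem contDiffOn_one_of_bddC11 {T σ B M : ℝ} {f : ℝ → ℝ} (h : BddC11 T σ f B M) (hσ : 0 ≤ σ) :
    ContDiffOn ℝ 1 f (Ioo (-T) T) := by
  rw [show (1 : WithTop ℕ∞) = 0 + 1 from (zero_add 1).symm,
    contDiffOn_succ_iff_deriv_of_isOpen isOpen_Ioo]
  exact ⟨fun t ht => (h.diff t ht).differentiableWithinAt, by simp,
    contDiffOn_zero.2 (h.continuousOn_deriv hσ)⟩

theorem contDiffOn_score (hn : 0 < n) {x : Fin n → Cov d} {V : Nuis d} {U : ℝ → Nuis d}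
    (hU : IsPath lam (empirical x) V c U) (z : Fin n → Fin 2 × Fin 2) :
    ContDiffOn ℝ 1 (fun t => (1 / (n : ℝ)) * ∑ i, Dstar lam (empirical x) (U t) (x i, z i))
      (Ioo (-t1 c) (t1 c)) := by
  obtain ⟨η, hw, h⟩ := hU.exists_pathAt hn
  exact contDiffOn_one_of_bddC11
    (BddC11.average hn fun i => h.bddC11_Dstar hw hn (x i) (z i)) (by positivity)

theorem contDiffOn_Ln (hn : 0 < n) (hw : w ∈ An)
    (hP : IsPath lam (empirical fun i => X i w) (U0 w) c
      (path lam (empirical fun i => X i w) (U0 w) c)) :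
    ContDiffOn ℝ 2 (Ln lam c X A Y U0 An w) (Ioo (-t1 c) (t1 c)) := by
  rw [show (2 : WithTop ℕ∞) = 1 + 1 from one_add_one_eq_two.symm,
    contDiffOn_succ_iff_deriv_of_isOpen isOpen_Ioo]
  refine ⟨fun t ht => (hasDerivAt_Ln hn hw hP ht).differentiableAt.differentiableWithinAt,
    by simp, ?_⟩
  exact (contDiffOn_score hn hP fun i => (A i w, Y i w)).congr
    fun t ht => (hasDerivAt_Ln hn hw hP ht).deriv

end LogLikelihood

end WATE

/-! ### Assembly of the theorem. -/

theorem mainTheorem2 (c cinit : ℝ) (hc : 0 < c) (hcinit : cinit ∈ Ioo (0 : ℝ) 1) :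
    ∃ t2 ∈ Ioo (0 : ℝ) (t1 c), ∃ m0 > (0 : ℝ),
      ∀ (d n : ℕ), 0 < d → 0 < n →
      -- the true law and a version of the conditional law of `(A,Y)` given `X`
      ∀ (Pstar : Measure (Obs d)) (_ : IsProbabilityMeasure Pstar)
        (_ : Pstar ≪ (volume : Measure (Cov d)).prod (Measure.count.prod Measure.count))
        (pc : Kernel (Cov d) (Fin 2 × Fin 2)) (_ : IsMarkovKernel pc)
        (_ : Pstar.IsCondKernel pc)
      -- the weight function
        (lam : ℝ → ℝ) (_ : ∀ u ∈ Icc (0 : ℝ) 1, 0 ≤ lam u)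
      -- the probability space, the sub-σ-field, the data and the initial estimate
        (Om : Type*) (G : MeasurableSpace Om) (mOm : MeasurableSpace Om) (_ : G ≤ mOm)
        (P : Measure Om) (_ : IsProbabilityMeasure P)
        (X : Fin n → Om → Cov d) (A Y : Fin n → Om → Fin 2)
        (_ : ∀ i, Measurable[G] (X i)) (_ : ∀ i, Measurable (A i)) (_ : ∀ i, Measurable (Y i))
        (U0 : Om → Nuis d) (_ : Measurable[G, borel (Nuis d)] U0)
        (_ : ∀ w, ValuesIn (U0 w) (Icc 0 1))
        (_ : CondIndepGiven G P (fun i w => (A i w, Y i w)))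
        (_ : ∀ i, ∀ a y : Fin 2,
          P⟦{w | (A i w, Y i w) = (a, y)} | G⟧ =ᵐ[P] fun w => (pc (X i w)).real {(a, y)})
      -- the good event
        (An : Set Om) (_ : MeasurableSet[G] An)
        (_ : ∀ w ∈ An,
          LocalBracketing Pstar pc lam (empirical fun i => X i w) (U0 w) c cinit),
      (∀ w ∈ An,
        -- the path exists and is unique
        IsPath lam (empirical fun i => X i w) (U0 w) c
          (path lam (empirical fun i => X i w) (U0 w) c) ∧
        (∀ V : ℝ → Nuis d, IsPath lam (empirical fun i => X i w) (U0 w) c V →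
          EqOn V (path lam (empirical fun i => X i w) (U0 w) c) (Ioo (-t1 c) (t1 c))) ∧
        -- `L_n` is twice continuously differentiable, and `L_n'` is the empirical EIF mean
        ContDiffOn ℝ 2 (Ln lam c X A Y U0 An w) (Ioo (-t1 c) (t1 c)) ∧
        ∀ t ∈ Ioo (-t1 c) (t1 c), deriv (Ln lam c X A Y U0 An w) t =
          (1 / (n : ℝ)) * ∑ i, Dstar lam (empirical fun j => X j w)
            (path lam (empirical fun j => X j w) (U0 w) c t) (X i w, (A i w, Y i w))) ∧
      -- `ℰ_n` is an event, with the stated conditional probability bound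
      MeasurableSet (En lam c t2 X A Y U0 An) ∧
      ∀ᵐ w ∂P, An.indicator (fun _ => (1 : ℝ)) w * (P⟦(En lam c t2 X A Y U0 An)ᶜ | G⟧) w
        ≤ 1 / m0 * Real.exp (-m0 * n) := by
  have hci := hcinit.1
  have hδ := deltaInit_pos hc hcinit.1
  have ht1 := t1_pos hc
  set κ : ℝ := (cinit * deltaInit c cinit / 16) ^ 2 / (2 * (45 * c⁻¹ ^ 10) ^ 2) with hκ
  have hκ0 : 0 < κ := by positivity
  -- The constant `c` is arbitrary here, so `δ_init < t1` may fail. The minimum guards against that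
  -- and equals `δ_init` as soon as `An` is nonempty. The cap `1/4` in `m0` makes `1/m0` absorb the
  -- prefactor `4`.
  refine ⟨min (deltaInit c cinit) (t1 c / 2),
    ⟨lt_min hδ (by linarith), (min_le_right _ _).trans_lt (by linarith)⟩,
    min κ (1 / 4), by positivity, ?_⟩
  intro d n hd hn Pstar _ hac pc _ hcond lam hlam Om G mOm hG P _ X A Y hX hA hY U0 hU0 hval hind hmarg
    An hAn hbr
  have hpath : ∀ w ∈ An, IsPath lam (empirical fun i => X i w) (U0 w) c
      (path lam (empirical fun i => X i w) (U0 w) c) := fun w hw => by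
    obtain ⟨η, hp, hr, -⟩ := hbr w hw
    exact isPath_path hn hp hr
  have hc4 : ∀ w ∈ An, c < 1 / 4 := fun w hw => (hbr w hw).pos.2
  refine ⟨fun w hw => ⟨hpath w hw, fun V hV => hV.eqOn hn hc (hc4 w hw) (hpath w hw),
    contDiffOn_Ln hn hw (hpath w hw), fun t ht => (hasDerivAt_Ln hn hw (hpath w hw) ht).deriv⟩, ?_⟩
  -- A point of `An` supplies `c < 1/4`; if `An` is empty the remaining claims are trivial.
  rcases An.eq_empty_or_nonempty with rfl | ⟨w0, hw0⟩
  · refine ⟨by simp [En], ae_of_all _ fun w => ?_⟩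
    simp only [indicator_empty, zero_mul]
    positivity
  have hc4 := hc4 w0 hw0
  rw [min_eq_left (deltaInit_lt hc hc4 hcinit).le]
  have hδt := deltaInit_lt hc hc4 hcinit
  have hI : ∀ t ∈ Icc (-deltaInit c cinit) (deltaInit c cinit), t ∈ Ioo (-t1 c) (t1 c) :=
    fun t ht => ⟨by linarith [ht.1], by linarith [ht.2]⟩
  set S : (Fin n → Fin 2 × Fin 2) → Om → ℝ → ℝ := fun z w t =>
    (1 / (n : ℝ)) * ∑ i, Dstar lam (empirical fun j => X j w)
      (path lam (empirical fun j => X j w) (U0 w) c t) (X i w, z i) with hS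
  -- The labels are frozen at `z`, which leaves randomness only in `X` and `U0` and so makes this
  -- event `G`-measurable.
  set good : (Fin n → Fin 2 × Fin 2) → Set Om := fun z => {w | w ∈ An ∧
    ∃! t, t ∈ Icc (-deltaInit c cinit) (deltaInit c cinit) ∧ S z w t = 0} with hgood
  have hgood_meas : ∀ z, MeasurableSet[G] (good z) := by
    intro z
    obtain ⟨H, hH⟩ := exists_continuous_score (d := d) lam hc hc4 hn z
    refine measurableSet_existsUnique_zero (mOm := G) (F := fun w t => H t (U0 w, fun i => X i w))
      hAn (fun t ht => ?_) (fun w hw t ht => ?_) (fun w hw => ?_) (by linarith)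
    · exact measurable_comp_of_continuous_prod (mOm := G) (hH t (hI t ht)).1 hU0
        (@measurable_pi_lambda _ _ _ G _ _ hX)
    · exact (hH t (hI t ht)).2 _ _ _ (hpath w hw)
    · exact (contDiffOn_score hn (hpath w hw) z).continuousOn.mono hI
  have hEn : ∀ w ∈ An, w ∈ En lam c (deltaInit c cinit) X A Y U0 An ↔
      w ∈ good fun i => (A i w, Y i w) := by
    intro w hw
    simp only [En, good, S, mem_ofPred_eq]
    refine and_congr_right fun _ => existsUnique_congr fun t => and_congr_right fun ht => ?_
    rw [(hasDerivAt_Ln hn hw (hpath w hw) (hI t ht)).deriv]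
  have hAY : ∀ i, Measurable fun w => (A i w, Y i w) := fun i => (hA i).prodMk (hY i)
  have hEn_meas : MeasurableSet (En lam c (deltaInit c cinit) X A Y U0 An) := by
    have : En lam c (deltaInit c cinit) X A Y U0 An =
        ⋃ z : Fin n → Fin 2 × Fin 2, {w | ∀ i, (A i w, Y i w) = z i} ∩ good z := by
      ext w
      simp only [mem_iUnion, mem_inter_iff, mem_ofPred_eq]
      constructor
      · intro hw
        exact ⟨_, fun i => rfl, (hEn w hw.1).1 hw⟩
      · rintro ⟨z, hz, hw⟩
        have : z = fun i => (A i w, Y i w) := funext fun i => (hz i).symm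
        exact (hEn w hw.1).2 (this ▸ hw)
    rw [this]
    refine MeasurableSet.iUnion fun z => MeasurableSet.inter ?_ (hG _ (hgood_meas z))
    rw [ofPred_forall]
    exact MeasurableSet.iInter fun i => hAY i (measurableSet_singleton (z i))
  refine ⟨hEn_meas, ?_⟩
  filter_upwards [indicator_mul_condExp_compl_ae_eq hG hAY hind
    (p := fun i w b => (pc (X i w)).real {b}) (fun i b => hmarg i b.1 b.2) hAn hgood_meas hEn
    hEn_meas] with w hw
  rw [hw]
  by_cases hwA : w ∈ An
  · have hb := (hbr w hwA).pi_real_not_existsUnique_le hcinit (hpath w hwA) hn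
    -- At fixed `w`, the sum is the mass of the bad label vectors under the product of the laws `pc
    -- (X i w)`.
    have heq : ∑ z : Fin n → Fin 2 × Fin 2,
        (An \ good z).indicator (fun _ => (1 : ℝ)) w * ∏ i, (pc (X i w)).real {z i} =
        (Measure.pi fun i => pc (X i w)).real {z | ¬ ∃! t,
          t ∈ Icc (-deltaInit c cinit) (deltaInit c cinit) ∧ S z w t = 0} := by
      rw [measureReal_eq_sum_indicator]
      refine Finset.sum_congr rfl fun z _ => ?_
      congr 1
      · by_cases hz : ∃! t, t ∈ Icc (-deltaInit c cinit) (deltaInit c cinit) ∧ S z w t = 0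
        · have hg : w ∈ good z := ⟨hwA, hz⟩
          rw [indicator_of_notMem (fun h => h.2 hg), indicator_of_notMem (by simpa using hz)]
        · have hg : w ∉ good z := fun h => hz h.2
          rw [indicator_of_mem (mem_sdiff _ |>.2 ⟨hwA, hg⟩), indicator_of_mem (by simpa using hz)]
      · simp [Measure.real, Measure.pi_singleton, ENNReal.toReal_prod]
    rw [heq]
    refine hb.trans ?_
    have hm : 0 < min κ (1 / 4) := by positivity
    refine mul_le_mul ?_ (Real.exp_le_exp.2 ?_) (Real.exp_pos _).le (by positivity)
    · rw [le_one_div (by norm_num) hm]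
      exact min_le_right _ _
    · have : min κ (1 / 4) ≤ κ := min_le_left _ _
      rw [neg_mul, neg_mul, neg_le_neg_iff]
      gcongr
  · have : ∀ z, (An \ good z).indicator (fun _ => (1 : ℝ)) w = 0 := fun z =>
      indicator_of_notMem (fun h => hwA h.1) _
    simp only [this, zero_mul, Finset.sum_const_zero]
    positivity
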